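/- For $x>0$ let $F(x):=\frac{e^{-i\pi/4}}{\sqrt{\pi}}\int_x^\infty e^{it^2}\,dt$ be the Fresnel integral (a convergent improper integral), and let $f(t):=e^{i(x^2+\pi/4)}\,\frac{x}{2\pi}\,\frac{e^{-t^2}}{x^2+it^2}$, an integrable function on $\mathbb{R}$ with $\int_{-\infty}^\infty f(t)\,dt=F(x)$. For $h>0$ let $$I_h:=h\sum_{k\in\mathbb{Z}}f\big((k-\tfrac12)h\big)$$ (an absolutely convergent series) be the untruncated trapezium (midpoint) rule, and let $I_h^*:=I_h+PC_h$ be the modified rule, where $$PC_h:=\tfrac12\big(1+i\tan(e^{i\pi/4}x\pi/h)\big).$$ Then, for every $h>0$ and every $x>0$, $$|F(x)-I_h^*|\le\Delta_h(x),\qquad \Delta_h(x):=\begin{cases}\delta_1(x), & 0\le \frac{x}{\sqrt2}\le\frac34\frac{\pi}{h},\\ \delta_2(x), & \frac34\frac{\pi}{h}<\frac{x}{\sqrt2}<\frac54\frac{\pi}{h},\\ \delta_3(x), & \frac{x}{\sqrt2}\ge\frac54\frac{\pi}{h},\end{cases}$$ where $$\delta_1(x):=\frac{x\,e^{-\pi^2/h^2}}{\sqrt{\pi}\,|\pi^2/h^2-x^2/2|\,(1-e^{-2\pi^2/h^2})}$$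 (the Hunter--Regan bound), $$\delta_2(x):=\frac{4hx\,e^{-\pi^2/h^2}}{\sqrt{\pi}\,\pi\,(\pi/h+x/\sqrt2)\,(1-e^{-2\pi^2/h^2})}\Big(1+2\sqrt{\pi}\,e^{-\beta\pi^2/h^2}\Big),$$ with $\beta=1-\frac{\sqrt2}{2}-\frac{2\sqrt2+1}{16}\approx0.0536$, and $$\delta_3(x):=\delta_1(x)+\frac{e^{-\sqrt2\,\pi x/h}}{1-e^{-\sqrt2\,\pi x/h}}.$$ Moreover, for each fixed $h>0$, $\delta_1(x)\to\infty$ as $x\to\sqrt2\,\pi/h$, whereas $\Delta_h$ is bounded above on $(0,\infty)$. -/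

import Mathlib

open Filter Topology

noncomputable section

namespace FresnelTrapezium

/-- The truncated integral `(e^{-iπ/4} / √π) ∫_x^R e^{i t²} dt`. -/
def fresnelPartial (x R : ℝ) : ℂ :=
  Complex.exp (-(Complex.I * (Real.pi : ℂ) / 4)) / (Real.sqrt Real.pi : ℂ) *
    ∫ t in x..R, Complex.exp (Complex.I * (t : ℂ) ^ 2)

/-- The Fresnel integral `F(x) = (e^{-iπ/4} / √π) ∫_x^∞ e^{i t²} dt`. The integral converges only
conditionally, so it is the limit of the integrals over `[x, R]` as `R → ∞`. -/
def fresnelF (x : ℝ) : ℂ :=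
  limUnder atTop (fun R : ℝ => fresnelPartial x R)

/-- The integrand `f(t) = e^{i(x² + π/4)} (x / (2π)) e^{-t²} / (x² + i t²)`. -/
def integrand (x t : ℝ) : ℂ :=
  Complex.exp (Complex.I * ((x : ℂ) ^ 2 + (Real.pi : ℂ) / 4)) * ((x : ℂ) / (2 * (Real.pi : ℂ))) *
    (Complex.exp (-(t : ℂ) ^ 2) / ((x : ℂ) ^ 2 + Complex.I * (t : ℂ) ^ 2))

/-- The nodes `τ_k = (k - 1/2) h`, for `k ∈ ℤ`. -/
def node (h : ℝ) (k : ℤ) : ℝ := ((k : ℝ) - 1 / 2) * h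

/-- The untruncated trapezium (midpoint) rule `I_h = h ∑_{k ∈ ℤ} f(τ_k)`. -/
def trapezium (h x : ℝ) : ℂ := (h : ℂ) * ∑' k : ℤ, integrand x (node h k)

/-- The pole correction `PC_h = (1/2) (1 + i tan(e^{iπ/4} x π / h))`. -/
def poleCorrection (h x : ℝ) : ℂ :=
  1 / 2 * (1 + Complex.I *
    Complex.tan (Complex.exp (Complex.I * (Real.pi : ℂ) / 4) * (x : ℂ) * (Real.pi : ℂ) / (h : ℂ)))

/-- The modified trapezium rule `I_h^* = I_h + PC_h`. -/
def modifiedTrapezium (h x : ℝ) : ℂ := trapezium h x + poleCorrection h x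

/-- The Hunter-Regan bound `δ₁`. -/
def delta1 (h x : ℝ) : ℝ :=
  x * Real.exp (-(Real.pi ^ 2 / h ^ 2)) /
    (Real.sqrt Real.pi * |Real.pi ^ 2 / h ^ 2 - x ^ 2 / 2| *
      (1 - Real.exp (-(2 * Real.pi ^ 2 / h ^ 2))))

/-- The constant `β = 1 - √2/2 - (2√2 + 1)/16`. -/
def beta : ℝ := 1 - Real.sqrt 2 / 2 - (2 * Real.sqrt 2 + 1) / 16

/-- The bound `δ₂`. -/
def delta2 (h x : ℝ) : ℝ :=
  4 * h * x * Real.exp (-(Real.pi ^ 2 / h ^ 2)) /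
    (Real.sqrt Real.pi * Real.pi * (Real.pi / h + x / Real.sqrt 2) *
      (1 - Real.exp (-(2 * Real.pi ^ 2 / h ^ 2)))) *
    (1 + 2 * Real.sqrt Real.pi * Real.exp (-(beta * Real.pi ^ 2 / h ^ 2)))

/-- The bound `δ₃`. -/
def delta3 (h x : ℝ) : ℝ :=
  delta1 h x + Real.exp (-(Real.sqrt 2 * Real.pi * x / h)) /
    (1 - Real.exp (-(Real.sqrt 2 * Real.pi * x / h)))

/-- The piecewise bound `Δ_h`; it is only used for `x > 0`. -/
def Delta (h x : ℝ) : ℝ :=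
  if x / Real.sqrt 2 ≤ 3 / 4 * (Real.pi / h) then delta1 h x
  else if x / Real.sqrt 2 < 5 / 4 * (Real.pi / h) then delta2 h x
  else delta3 h x

end FresnelTrapezium

end

noncomputable section

namespace FresnelTrapezium

open MeasureTheory Set Complex

/-! Write z = `pole x`, a = x/√2 (both the real and the imaginary part of z), H = π/h and G =
`gaussLaplace`. Partial fractions at the poles ±z, together with i/(z+t) = ∫_0^∞ e^{is(z+t)} ds,
turn the Fourier integral of f at frequency c into a constant of modulus 1/(4√π) times G(z,c) +
G(z,-c). At c = 0 this is F(x) (`fourierAt_zero`, `tendsto_fresnelPartial`), so Poisson summation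
(`trapezium_eq`) writes I_h - F as 2∑(-1)^n times the Fourier integrals at c = 2nH, n ≥ 1.

Completing the half-line Gaussian integral to the whole line (`gaussLaplace_neg`) rewrites each
Fourier integral as ½e^{icz} plus the same constant times G(z,c) - G(-z,c) (`fourierAt_eq`). This is
the residue at z, found without moving a contour. The residues form a geometric series that cancels
against PC_h (`hasSum_poleCorrection`), so only the remainders need bounds.

Replacing the Gaussian by an exponential of rate k = ±H bounds G. For a < H this is applied to the
difference G(z,c) - G(-z,c) and gives δ₁. For a > H it is applied to the sum G(z,c) + G(z,-c), and
PC_h is bounded separately, which gives δ₃. Both degenerate at a = H. There an integration by parts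
(`norm_gaussLaplace_le_two_div`) yields a constant of size 2/a, whence δ₂. -/

/-! ### One-sided Gaussian transforms -/

/-- The one-sided Gaussian transform `∫_0^∞ e^{isz} e^{-(c+s)²/4} ds`. -/
def gaussLaplace (z : ℂ) (c : ℝ) : ℂ :=
  ∫ s : ℝ in Ioi 0, cexp (I * s * z) * cexp (-((c + s : ℝ) : ℂ) ^ 2 / 4)

lemma integrable_gaussLaplace_integrand (z : ℂ) (c : ℝ) :
    Integrable (fun s : ℝ => cexp (I * s * z) * cexp (-((c + s : ℝ) : ℂ) ^ 2 / 4)) := by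
  have := integrable_cexp_quadratic' (b := -1 / 4) (by norm_num) (I * z - c / 2) (-c ^ 2 / 4)
  refine this.congr (Eventually.of_forall fun s => ?_)
  simp only [← Complex.exp_add]
  congr 1
  push_cast
  ring

lemma four_pi_cpow_half : ((4 * Real.pi : ℂ)) ^ (1 / 2 : ℂ) = 2 * (√Real.pi : ℂ) := by
  have h : (4 * Real.pi : ℂ) = ((4 * Real.pi : ℝ) : ℂ) := by push_cast; rfl
  rw [h, show (1 / 2 : ℂ) = ((1 / 2 : ℝ) : ℂ) by push_cast; rfl,
    ← Complex.ofReal_cpow (by positivity), ← Real.sqrt_eq_rpow,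
    Real.sqrt_mul (by norm_num), show (4 : ℝ) = 2 ^ 2 by norm_num, Real.sqrt_sq (by norm_num)]
  push_cast; rfl

lemma integral_full_gaussLaplace (z : ℂ) (c : ℝ) :
    ∫ s : ℝ, cexp (I * s * z) * cexp (-((-c + s : ℝ) : ℂ) ^ 2 / 4) =
      2 * √Real.pi * cexp (-z ^ 2 + I * c * z) := by
  have := integral_cexp_quadratic (b := -1 / 4) (by norm_num) (I * z + c / 2) (-c ^ 2 / 4)
  rw [show (Real.pi : ℂ) / -(-1 / 4) = 4 * Real.pi by ring, four_pi_cpow_half] at this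
  rw [show -z ^ 2 + I * c * z = -(c : ℂ) ^ 2 / 4 - (I * z + c / 2) ^ 2 / (4 * (-1 / 4)) by
    linear_combination (-z ^ 2) * I_sq, ← this]
  refine integral_congr_ae (Eventually.of_forall fun s => ?_)
  simp only [← Complex.exp_add]
  congr 1
  push_cast
  ring

/-- The substitution s ↦ -s identifies the missing half-line of the full Gaussian integral with the
transform at (-z, c). Since the transform is entire in z, this reflection takes over the role of the
residue theorem. -/
lemma gaussLaplace_neg (z : ℂ) (c : ℝ) :
    gaussLaplace z (-c) = 2 * √Real.pi * cexp (-z ^ 2 + I * c * z) - gaussLaplace (-z) c := by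
  have hi := integrable_gaussLaplace_integrand z (-c)
  rw [← integral_full_gaussLaplace,
    ← intervalIntegral.integral_Iic_add_Ioi (b := 0) hi.integrableOn hi.integrableOn]
  have h := integral_comp_neg_Ioi 0
    (fun s : ℝ => cexp (I * s * z) * cexp (-((-c + s : ℝ) : ℂ) ^ 2 / 4))
  rw [neg_zero] at h
  rw [← h, gaussLaplace, gaussLaplace, eq_sub_iff_add_eq, add_comm]
  congr 1
  refine integral_congr_ae (Eventually.of_forall fun s => ?_)
  simp only [← Complex.exp_add]
  congr 1
  push_cast
  ring

lemma integral_gauss_fourier (c : ℝ) :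
    ∫ t : ℝ, cexp (-(t : ℂ) ^ 2) * cexp (I * c * t) = √Real.pi * cexp (-(c : ℂ) ^ 2 / 4) := by
  have := fourierIntegral_gaussian (b := 1) (by norm_num) (c : ℂ)
  rw [div_one, mul_one, show (1 / 2 : ℂ) = ((1 / 2 : ℝ) : ℂ) by push_cast; rfl,
    ← Complex.ofReal_cpow (by positivity), ← Real.sqrt_eq_rpow] at this
  rw [← this]
  refine integral_congr_ae (Eventually.of_forall fun s => ?_)
  simp [mul_comm]

lemma integral_exp_I_mul {w : ℂ} (hw : 0 < w.im) :
    ∫ s : ℝ in Ioi 0, cexp (I * s * w) = I / w := by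
  have h := integral_exp_mul_complex_Ioi (a := I * w) (by simpa using hw) 0
  have hw0 : w ≠ 0 := by rintro rfl; simp at hw
  simp only [ofReal_zero, mul_zero, Complex.exp_zero] at h
  rw [show I / w = -1 / (I * w) by field_simp; simp, ← h]
  refine integral_congr_ae (Eventually.of_forall fun s => ?_)
  simp only
  congr 1
  ring

lemma integrable_gauss_mul_exp {z : ℂ} (hz : 0 < z.im) (c : ℝ) :
    Integrable (Function.uncurry fun t s : ℝ =>
        cexp (-(t : ℂ) ^ 2) * cexp (I * c * t) * cexp (I * s * (z + t)))
      (volume.prod (volume.restrict (Ioi 0))) := by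
  have h1 : Integrable (fun t : ℝ => Real.exp (-1 * t ^ 2)) :=
    integrable_exp_neg_mul_sq (by norm_num)
  have h2 : Integrable (fun s : ℝ => Real.exp (-z.im * s)) (volume.restrict (Ioi 0)) :=
    integrableOn_exp_mul_Ioi (by linarith) 0
  refine (h1.mul_prod h2).mono' (by
    apply Continuous.aestronglyMeasurable
    unfold Function.uncurry
    fun_prop) (Eventually.of_forall fun p => ?_)
  simp only [Function.uncurry, norm_mul, Complex.norm_exp]
  rw [← Real.exp_add, ← Real.exp_add, ← Real.exp_add]
  apply le_of_eq
  congr 1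
  simp [← ofReal_pow]
  ring

/-- Expand i/(z+t) as a Laplace integral in s, exchange the integrals, and evaluate the inner
Gaussian Fourier integral at frequency c + s. -/
lemma integral_gauss_div_add {z : ℂ} (hz : 0 < z.im) (c : ℝ) :
    ∫ t : ℝ, cexp (-(t : ℂ) ^ 2) * cexp (I * c * t) * (I / (z + t)) =
      √Real.pi * gaussLaplace z c := by
  have h1 : ∀ t : ℝ, cexp (-(t : ℂ) ^ 2) * cexp (I * c * t) * (I / (z + t)) =
      ∫ s : ℝ in Ioi 0, cexp (-(t : ℂ) ^ 2) * cexp (I * c * t) * cexp (I * s * (z + t)) := by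
    intro t
    rw [integral_const_mul, integral_exp_I_mul (by simpa using hz)]
  simp_rw [h1]
  rw [integral_integral_swap (integrable_gauss_mul_exp hz c), gaussLaplace, ← integral_const_mul]
  refine integral_congr_ae (Eventually.of_forall fun s => ?_)
  simp only
  rw [mul_left_comm, ← integral_gauss_fourier, ← integral_const_mul]
  refine integral_congr_ae (Eventually.of_forall fun t => ?_)
  simp only [← Complex.exp_add]
  congr 1
  push_cast
  ring

lemma integrable_gauss_div_add {z : ℂ} (hz : 0 < z.im) (c : ℝ) :
    Integrable fun t : ℝ => cexp (-(t : ℂ) ^ 2) * cexp (I * c * t) * (I / (z + t)) := by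
  refine (integrable_gauss_mul_exp hz c).integral_prod_left.congr
    (Eventually.of_forall fun t => ?_)
  simp only [Function.uncurry]
  rw [integral_const_mul, integral_exp_I_mul (by simpa using hz)]

/-! ### Poles and Fourier integrals of the integrand -/

/-- The pole `e^{iπ/4} x` of the integrand. -/
def pole (x : ℝ) : ℂ := cexp (I * Real.pi / 4) * x

lemma exp_I_pi_div_four : cexp (I * Real.pi / 4) = (√2 / 2 : ℝ) * (1 + I) := by
  rw [show I * (Real.pi : ℂ) / 4 = ((Real.pi / 4 : ℝ) : ℂ) * I by push_cast; ring,
    Complex.exp_mul_I, ← Complex.ofReal_cos, ← Complex.ofReal_sin, Real.cos_pi_div_four,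
    Real.sin_pi_div_four]
  ring

lemma div_sqrt_two (x : ℝ) : x / √2 = √2 / 2 * x := by
  have : √2 ^ 2 = 2 := Real.sq_sqrt (by norm_num)
  field_simp
  rw [this]

lemma pole_eq (x : ℝ) : pole x = (x / √2 : ℝ) * (1 + I) := by
  rw [pole, exp_I_pi_div_four, div_sqrt_two]
  push_cast
  ring

lemma pole_re (x : ℝ) : (pole x).re = x / √2 := by rw [pole_eq, re_ofReal_mul]; simp

lemma pole_im (x : ℝ) : (pole x).im = x / √2 := by rw [pole_eq, im_ofReal_mul]; simp

lemma pole_sq (x : ℝ) : pole x ^ 2 = I * x ^ 2 := by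
  rw [pole, mul_pow, ← Complex.exp_nat_mul,
    show ((2 : ℕ) : ℂ) * (I * Real.pi / 4) = Real.pi / 2 * I by push_cast; ring,
    Complex.exp_pi_div_two_mul_I]

lemma integrand_eq {x : ℝ} (hx : 0 < x) (t : ℝ) :
    integrand x t = cexp (I * x ^ 2) / (4 * Real.pi) *
      (cexp (-(t : ℂ) ^ 2) * (I / (pole x + t)) + cexp (-(t : ℂ) ^ 2) * (I / (pole x - t))) := by
  have him : 0 < (pole x).im := by rw [pole_im]; positivity
  have h1 : pole x + t ≠ 0 := fun h => by
    have := congrArg Complex.im h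
    simp at this; linarith
  have h2 : pole x - t ≠ 0 := fun h => by
    have := congrArg Complex.im h
    simp at this; linarith
  have h3 : (x : ℂ) ^ 2 + I * t ^ 2 = -I * ((pole x + t) * (pole x - t)) := by
    linear_combination I * pole_sq x + (x ^ 2 : ℂ) * I_sq
  rw [integrand, h3]
  have hpi : (Real.pi : ℂ) ≠ 0 := by exact_mod_cast Real.pi_ne_zero
  have h4 : cexp (I * (x ^ 2 + Real.pi / 4)) * x = cexp (I * x ^ 2) * pole x := by
    rw [pole, ← mul_assoc, ← Complex.exp_add]; congr 2; ring
  rw [show cexp (I * (x ^ 2 + Real.pi / 4)) * ((x : ℂ) / (2 * Real.pi)) =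
    cexp (I * x ^ 2) * pole x / (2 * Real.pi) by rw [← h4]; ring]
  have := I_ne_zero
  field_simp
  linear_combination (-4 * pole x) * I_sq

/-- The Fourier-type integral `∫ e^{ict} f(t) dt` of the integrand. -/
def fourierAt (x c : ℝ) : ℂ := ∫ t : ℝ, cexp (I * c * t) * integrand x t

lemma integrable_exp_mul_integrand {x : ℝ} (hx : 0 < x) (c : ℝ) :
    Integrable (fun t : ℝ => cexp (I * c * t) * integrand x t) ∧
      fourierAt x c = cexp (I * x ^ 2) / (4 * √Real.pi) *
        (gaussLaplace (pole x) c + gaussLaplace (pole x) (-c)) := by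
  have him : 0 < (pole x).im := by rw [pole_im]; positivity
  have hi1 := integrable_gauss_div_add him c
  -- The reflection t ↦ -t reduces the fraction i/(z-t) at frequency c to i/(z+t) at frequency -c.
  have hi2 := (integrable_gauss_div_add him (-c)).comp_neg
  have he2 := integral_gauss_div_add him (-c)
  rw [← integral_neg_eq_self] at he2
  have key : (fun t : ℝ => cexp (I * c * t) * integrand x t) = fun t : ℝ =>
      cexp (I * x ^ 2) / (4 * Real.pi) *
        (cexp (-(t : ℂ) ^ 2) * cexp (I * c * t) * (I / (pole x + t)) +
        cexp (-((-t : ℝ) : ℂ) ^ 2) * cexp (I * (-c : ℝ) * (-t : ℝ)) *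
          (I / (pole x + (-t : ℝ)))) := by
    funext t
    rw [integrand_eq hx]
    push_cast
    rw [neg_sq, show I * -(c : ℂ) * -(t : ℂ) = I * c * t by ring, ← sub_eq_add_neg]
    ring
  refine ⟨by rw [key]; exact (hi1.add hi2).const_mul _, ?_⟩
  rw [fourierAt, key, integral_const_mul, integral_add hi1 hi2, integral_gauss_div_add him c, he2]
  have hpi : (√Real.pi : ℂ) * √Real.pi = Real.pi := by
    rw [← ofReal_mul, Real.mul_self_sqrt Real.pi_pos.le]
  have h0 : (√Real.pi : ℂ) ≠ 0 := by
    exact_mod_cast (Real.sqrt_pos.2 Real.pi_pos).ne'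
  rw [← hpi]
  field_simp

lemma fourierAt_neg {x : ℝ} (hx : 0 < x) (c : ℝ) : fourierAt x (-c) = fourierAt x c := by
  rw [(integrable_exp_mul_integrand hx c).2, (integrable_exp_mul_integrand hx (-c)).2, neg_neg,
    add_comm]

/-- The factor e^{-z²} from the reflection formula cancels the prefactor e^{ix²}, because z² = ix².
-/
lemma fourierAt_eq {x : ℝ} (hx : 0 < x) (c : ℝ) :
    fourierAt x c = 1 / 2 * cexp (I * c * pole x) + cexp (I * x ^ 2) / (4 * √Real.pi) *
      (gaussLaplace (pole x) c - gaussLaplace (-pole x) c) := by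
  have h0 : (√Real.pi : ℂ) ≠ 0 := by
    exact_mod_cast (Real.sqrt_pos.2 Real.pi_pos).ne'
  rw [(integrable_exp_mul_integrand hx c).2, gaussLaplace_neg, pole_sq, Complex.exp_add,
    Complex.exp_neg]
  have := Complex.exp_ne_zero (I * x ^ 2)
  field_simp
  ring

/-! ### The Fresnel integral as the Fourier integral at frequency zero -/

/-- The unit complex number `e^{-iπ/4}`. -/
def kappa : ℂ := (√2 / 2 : ℝ) * (1 - I)

lemma exp_neg_I_pi_div_four : cexp (-(I * Real.pi / 4)) = kappa := by
  rw [show -(I * (Real.pi : ℂ) / 4) = ((-(Real.pi / 4) : ℝ) : ℂ) * I by push_cast; ring,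
    Complex.exp_mul_I, ← Complex.ofReal_cos, ← Complex.ofReal_sin, Real.cos_neg, Real.sin_neg,
    Real.cos_pi_div_four, Real.sin_pi_div_four, kappa]
  push_cast
  ring

lemma norm_kappa : ‖kappa‖ = 1 := by
  rw [← exp_neg_I_pi_div_four, Complex.norm_exp]
  simp

lemma kappa_sq : kappa ^ 2 = -I := by
  rw [← exp_neg_I_pi_div_four, ← Complex.exp_nat_mul,
    show ((2 : ℕ) : ℂ) * (-(I * Real.pi / 4)) = -(Real.pi / 2 * I) by push_cast; ring,
    Complex.exp_neg, Complex.exp_pi_div_two_mul_I, Complex.inv_I]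

lemma kappa_re : kappa.re = √2 / 2 := by rw [kappa, re_ofReal_mul]; simp

lemma kappa_mul (y : ℝ) : kappa * y = -I * pole y := by
  rw [pole_eq, kappa, div_sqrt_two]
  push_cast
  linear_combination (√2 / 2 * y : ℂ) * I_sq

lemma norm_exp_neg_add_kappa_sq (u y : ℝ) :
    ‖cexp (-((u : ℂ) + kappa * y) ^ 2)‖ = Real.exp (-(u ^ 2 + √2 * u * y)) := by
  rw [Complex.norm_exp]
  congr 1
  rw [show -((u : ℂ) + kappa * y) ^ 2 = -(u ^ 2 : ℝ) - (2 * u * y : ℝ) * kappa + (y ^ 2 : ℝ) * I by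
    push_cast
    linear_combination (-y ^ 2 : ℂ) * kappa_sq]
  rw [add_re, sub_re, neg_re, ofReal_re, re_ofReal_mul, kappa_re, re_ofReal_mul, I_re]
  ring

/-- The integral `∫_0^∞ e^{-(u + e^{-iπ/4} y)²} du`. -/
def gaussRay (y : ℝ) : ℂ := ∫ u : ℝ in Ioi 0, cexp (-((u : ℂ) + kappa * y) ^ 2)

/-- Substituting s = 2u completes the square: the exponent becomes -(u + κx)² with κx = -iz, up to
the constant -ix². -/
lemma fourierAt_zero {x : ℝ} (hx : 0 < x) : fourierAt x 0 = gaussRay x / √Real.pi := by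
  rw [(integrable_exp_mul_integrand hx 0).2, neg_zero]
  have h : gaussLaplace (pole x) 0 = 2 * (cexp (-(I * x ^ 2)) * gaussRay x) := by
    have := integral_comp_mul_left_Ioi
      (fun s : ℝ => cexp (I * s * pole x) * cexp (-((0 + s : ℝ) : ℂ) ^ 2 / 4)) 0
      (b := 2) (by norm_num)
    rw [mul_zero] at this
    rw [gaussLaplace, gaussRay, ← integral_const_mul]
    have h2 : ∀ w : ℂ, w = 2 * ((2 : ℝ)⁻¹ • w) := fun w => by simp
    rw [h2 (∫ s : ℝ in Ioi 0, _), ← this]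
    congr 1
    refine integral_congr_ae (Eventually.of_forall fun s => ?_)
    simp only [← Complex.exp_add]
    congr 1
    rw [kappa_mul]
    push_cast
    linear_combination -pole_sq x + pole x ^ 2 * I_sq
  rw [h, Complex.exp_neg]
  have h0 : (√Real.pi : ℂ) ≠ 0 := by
    exact_mod_cast (Real.sqrt_pos.2 Real.pi_pos).ne'
  have := Complex.exp_ne_zero (I * x ^ 2)
  field_simp
  ring

lemma norm_gaussRay_le {y : ℝ} (hy : 0 < y) : ‖gaussRay y‖ ≤ 1 / (√2 * y) := by
  have h2 : 0 < √2 := by positivity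
  have hneg : -(√2 * y) < 0 := by nlinarith [mul_pos h2 hy]
  have he := integral_exp_mul_Ioi hneg 0
  rw [mul_zero, Real.exp_zero, neg_div_neg_eq] at he
  rw [← he]
  refine norm_integral_le_of_norm_le (integrableOn_exp_mul_Ioi hneg 0)
    (Eventually.of_forall fun u => ?_)
  rw [norm_exp_neg_add_kappa_sq, Real.exp_le_exp]
  nlinarith [sq_nonneg u]

lemma tendsto_gaussRay : Tendsto gaussRay atTop (𝓝 0) := by
  have : Tendsto (fun y : ℝ => 1 / (√2 * y)) atTop (𝓝 0) := by
    simp_rw [one_div]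
    exact tendsto_inv_atTop_zero.comp (tendsto_id.const_mul_atTop (by positivity))
  exact squeeze_zero_norm' ((eventually_gt_atTop 0).mono fun y hy => norm_gaussRay_le hy) this

lemma integrable_gaussRay {y : ℝ} (hy : 0 < y) :
    Integrable (fun u : ℝ => cexp (-((u : ℂ) + kappa * y) ^ 2)) (volume.restrict (Ioi 0)) := by
  have h2 : 0 < √2 := by positivity
  have hneg : -(√2 * y) < 0 := by nlinarith [mul_pos h2 hy]
  refine (integrableOn_exp_mul_Ioi hneg 0).mono'
    (by apply Continuous.aestronglyMeasurable; fun_prop) (Eventually.of_forall fun u => ?_)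
  rw [norm_exp_neg_add_kappa_sq, Real.exp_le_exp]
  nlinarith [sq_nonneg u]

/-- The y-derivative of the integrand is κ times its u-derivative, so the differentiated integral
telescopes to -κe^{-(κy)²}, and κ² = -i. -/
lemma hasDerivAt_gaussRay {y : ℝ} (hy : 0 < y) :
    HasDerivAt gaussRay (-kappa * cexp (I * (y : ℂ) ^ 2)) y := by
  have hbase : ∀ w : ℂ, HasDerivAt (fun w : ℂ => cexp (-w ^ 2)) (cexp (-w ^ 2) * -(2 * w)) w := by
    intro w
    have := ((hasDerivAt_id w).pow 2).neg.cexp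
    simpa using this
  have hmain := hasDerivAt_integral_of_dominated_loc_of_deriv_le (𝕜 := ℝ)
    (μ := volume.restrict (Ioi (0 : ℝ))) (x₀ := y) (s := Ioo 0 (y + 1))
    (F := fun y u : ℝ => cexp (-((u : ℂ) + kappa * y) ^ 2))
    (F' := fun y u : ℝ => cexp (-((u : ℂ) + kappa * y) ^ 2) * -(2 * ((u : ℂ) + kappa * y)) * kappa)
    (bound := fun u : ℝ => 2 * (u * Real.exp (-1 * u ^ 2)) + 2 * (y + 1) * Real.exp (-1 * u ^ 2))
    (Ioo_mem_nhds hy (by linarith))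
    (Eventually.of_forall fun y => by apply Continuous.aestronglyMeasurable; fun_prop)
    (integrable_gaussRay hy) (by apply Continuous.aestronglyMeasurable; fun_prop)
    ?_ (((integrable_mul_exp_neg_mul_sq (by norm_num)).const_mul 2).add
        ((integrable_exp_neg_mul_sq (by norm_num)).const_mul _)).integrableOn ?_
  · obtain ⟨hint, hd⟩ := hmain
    have hF : ∀ u : ℝ, HasDerivAt (fun u : ℝ => kappa * cexp (-((u : ℂ) + kappa * y) ^ 2))
        (cexp (-((u : ℂ) + kappa * y) ^ 2) * -(2 * ((u : ℂ) + kappa * y)) * kappa) u := by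
      intro u
      have h1 : HasDerivAt (fun u : ℝ => (u : ℂ) + kappa * y) 1 u :=
        (Complex.ofRealCLM.hasDerivAt (x := u)).add_const _
      have := ((hbase ((u : ℂ) + kappa * y)).comp u h1).const_mul kappa
      refine this.congr_deriv ?_
      ring
    have hlim : Tendsto (fun u : ℝ => kappa * cexp (-((u : ℂ) + kappa * y) ^ 2)) atTop (𝓝 0) := by
      rw [← mul_zero kappa]
      refine Tendsto.const_mul _ ?_
      have h0 : Tendsto (fun u : ℝ => Real.exp (-u)) atTop (𝓝 0) :=
        Real.tendsto_exp_neg_atTop_nhds_zero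
      refine squeeze_zero_norm' ((eventually_ge_atTop 1).mono fun u hu => ?_) h0
      rw [norm_exp_neg_add_kappa_sq, Real.exp_le_exp]
      have : 0 ≤ √2 * u * y := by positivity
      nlinarith
    have hval := integral_Ioi_of_hasDerivAt_of_tendsto' (a := 0) (fun u _ => hF u) hint hlim
    rw [hval] at hd
    refine hd.congr_deriv ?_
    rw [ofReal_zero, zero_add, mul_pow, kappa_sq, zero_sub]
    ring_nf
  · filter_upwards [ae_restrict_mem measurableSet_Ioi] with u hu v hv
    rw [mem_Ioi] at hu
    rw [norm_mul, norm_mul, norm_kappa, mul_one, norm_exp_neg_add_kappa_sq, norm_neg, norm_mul,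
      Complex.norm_two]
    have h1 : ‖(u : ℂ) + kappa * v‖ ≤ u + (y + 1) := by
      refine (norm_add_le _ _).trans ?_
      rw [norm_mul, norm_kappa, one_mul, norm_real, norm_real, Real.norm_of_nonneg hu.le,
        Real.norm_of_nonneg hv.1.le]
      linarith [hv.2]
    have h2 : Real.exp (-(u ^ 2 + √2 * u * v)) ≤ Real.exp (-1 * u ^ 2) := by
      rw [Real.exp_le_exp]
      have : 0 ≤ √2 * u * v := by have := hv.1; positivity
      linarith
    calc _ ≤ Real.exp (-1 * u ^ 2) * (2 * (u + (y + 1))) := by gcongr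
      _ = _ := by ring
  · refine Eventually.of_forall fun u v _ => ?_
    have h1 : HasDerivAt (fun v : ℝ => (u : ℂ) + kappa * v) kappa v := by
      simpa using ((Complex.ofRealCLM.hasDerivAt (x := v)).const_mul kappa).const_add (u : ℂ)
    have h2 := (hbase ((u : ℂ) + kappa * v)).comp v h1
    exact h2

lemma fresnelPartial_eq {x R : ℝ} (hx : 0 < x) (hR : 0 < R) :
    fresnelPartial x R = (gaussRay x - gaussRay R) / √Real.pi := by
  have hpos : ∀ t ∈ uIcc x R, 0 < t := fun t ht => lt_of_lt_of_le (lt_min hx hR) ht.1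
  have h := intervalIntegral.integral_eq_sub_of_hasDerivAt (a := x) (b := R)
    (fun t ht => hasDerivAt_gaussRay (hpos t ht))
    (by apply Continuous.intervalIntegrable; fun_prop)
  rw [intervalIntegral.integral_const_mul] at h
  rw [fresnelPartial, exp_neg_I_pi_div_four]
  linear_combination (-1 / √Real.pi : ℂ) * h

lemma tendsto_fresnelPartial {x : ℝ} (hx : 0 < x) :
    Tendsto (fun R : ℝ => fresnelPartial x R) atTop (𝓝 (fourierAt x 0)) := by
  rw [fourierAt_zero hx]
  have : Tendsto (fun R : ℝ => (gaussRay x - gaussRay R) / √Real.pi) atTop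
      (𝓝 ((gaussRay x - 0) / √Real.pi)) := (tendsto_gaussRay.const_sub _).div_const _
  rw [sub_zero] at this
  exact this.congr' ((eventually_gt_atTop 0).mono fun R hR => (fresnelPartial_eq hx hR).symm)

lemma fresnelF_eq {x : ℝ} (hx : 0 < x) : fresnelF x = fourierAt x 0 :=
  (tendsto_fresnelPartial hx).limUnder_eq

/-! ### Bounds for the Gaussian transforms -/

lemma norm_exp_I_mul (s : ℝ) (z : ℂ) : ‖cexp (I * s * z)‖ = Real.exp (-z.im * s) := by
  rw [Complex.norm_exp]
  congr 1
  simp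
  ring

/-- This is ((c+s)/2 - k)² ≥ 0, the tangent line to the parabola. The rate k is free and is later
set to ±π/h. -/
lemma norm_exp_neg_sq_le (c k s : ℝ) :
    ‖cexp (-((c + s : ℝ) : ℂ) ^ 2 / 4)‖ ≤ Real.exp (-(k * c - k ^ 2)) * Real.exp (-k * s) := by
  rw [show -((c + s : ℝ) : ℂ) ^ 2 / 4 = ((-(c + s) ^ 2 / 4 : ℝ) : ℂ) by push_cast; ring,
    ← Complex.ofReal_exp, Complex.norm_of_nonneg (Real.exp_pos _).le, ← Real.exp_add,
    Real.exp_le_exp]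
  nlinarith [sq_nonneg ((c + s) / 2 - k)]

lemma norm_gaussLaplace_le {z : ℂ} (c : ℝ) {k : ℝ} (hk : 0 < z.im + k) :
    ‖gaussLaplace z c‖ ≤ Real.exp (-(k * c - k ^ 2)) / (z.im + k) := by
  have hneg : -(z.im + k) < 0 := by linarith
  have he := integral_exp_mul_Ioi hneg 0
  rw [mul_zero, Real.exp_zero, neg_div_neg_eq] at he
  rw [div_eq_mul_one_div, ← he, ← integral_const_mul]
  refine norm_integral_le_of_norm_le ((integrableOn_exp_mul_Ioi hneg 0).const_mul _)
    (Eventually.of_forall fun s => ?_)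
  rw [norm_mul, norm_exp_I_mul]
  calc _ ≤ Real.exp (-z.im * s) * (Real.exp (-(k * c - k ^ 2)) * Real.exp (-k * s)) := by
        gcongr; exact norm_exp_neg_sq_le c k s
    _ = Real.exp (-(k * c - k ^ 2)) * (Real.exp (-z.im * s) * Real.exp (-k * s)) := by ring
    _ = _ := by rw [← Real.exp_add]; congr 2; ring

/-- With u = as, the squared modulus is 4(sinh²u + sin²u), and |sin u| ≤ sinh u. The resulting √2 is
what turns a into x in the numerator of δ₁. -/
lemma norm_exp_sub_exp_le {a : ℝ} (ha : 0 ≤ a) {s : ℝ} (hs : 0 ≤ s) :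
    ‖cexp (I * s * (a * (1 + I))) - cexp (I * s * -(a * (1 + I)))‖ ≤
      √2 * (Real.exp (a * s) - Real.exp (-a * s)) := by
  set u := s * a with hu
  have hu0 : 0 ≤ u := mul_nonneg hs ha
  have h1 : cexp (I * s * (a * (1 + I))) - cexp (I * s * -(a * (1 + I))) =
      ⟨-(2 * Real.cos u * Real.sinh u), 2 * Real.sin u * Real.cosh u⟩ := by
    rw [show I * (s : ℂ) * (a * (1 + I)) = ((-u : ℝ) : ℂ) + (u : ℝ) * I by
        rw [hu]; push_cast; linear_combination (s * a : ℂ) * I_sq,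
      show I * (s : ℂ) * -(a * (1 + I)) = (u : ℂ) + (-u : ℝ) * I by
        rw [hu]; push_cast; linear_combination (-(s * a) : ℂ) * I_sq,
      Complex.exp_add, Complex.exp_add, Complex.exp_mul_I, Complex.exp_mul_I,
      ← Complex.ofReal_cos, ← Complex.ofReal_sin, ← Complex.ofReal_cos, ← Complex.ofReal_sin,
      ← Complex.ofReal_exp, ← Complex.ofReal_exp, Real.cos_neg, Real.sin_neg]
    apply Complex.ext
    · simp [Real.sinh_eq, -ofReal_cos, -ofReal_sin, -ofReal_exp]
      ring
    · simp [Real.cosh_eq, -ofReal_cos, -ofReal_sin, -ofReal_exp]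
      ring
  have hsinh : 0 ≤ Real.sinh u := Real.sinh_nonneg_iff.2 hu0
  have hsin : Real.sin u ^ 2 ≤ Real.sinh u ^ 2 := by
    rw [sq_le_sq, abs_of_nonneg hsinh]
    exact (Real.abs_sin_le_abs.trans_eq (abs_of_nonneg hu0)).trans (Real.self_le_sinh_iff.2 hu0)
  have h2 : Real.exp (a * s) - Real.exp (-a * s) = 2 * Real.sinh u := by
    rw [Real.sinh_eq, hu]; ring_nf
  rw [h1, h2, ← abs_of_nonneg (by positivity : 0 ≤ √2 * (2 * Real.sinh u)), ← abs_norm,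
    ← sq_le_sq, Complex.sq_norm, Complex.normSq_apply, mul_pow, Real.sq_sqrt (by norm_num)]
  have h3 := Real.sin_sq_add_cos_sq u
  have h4 := Real.cosh_sq u
  have : (-(2 * Real.cos u * Real.sinh u)) * (-(2 * Real.cos u * Real.sinh u)) +
      2 * Real.sin u * Real.cosh u * (2 * Real.sin u * Real.cosh u) =
      4 * (Real.sinh u ^ 2 + Real.sin u ^ 2) := by
    linear_combination 4 * Real.sin u ^ 2 * h4 + 4 * Real.sinh u ^ 2 * h3
  dsimp only
  rw [this]
  nlinarith

/-- Estimating the difference under one integral gives √2(1/(k-a) - 1/(k+a)), which vanishes with x.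
The triangle inequality would give the sum of these fractions. -/
lemma norm_gaussLaplace_sub_le {x : ℝ} (hx : 0 < x) (c : ℝ) {k : ℝ} (hk : x / √2 < k) :
    ‖gaussLaplace (pole x) c - gaussLaplace (-pole x) c‖ ≤
      Real.exp (-(k * c - k ^ 2)) * (2 * x / (k ^ 2 - x ^ 2 / 2)) := by
  set a := x / √2 with ha
  have ha0 : 0 < a := by positivity
  have hxa : x = √2 * a := by rw [ha]; field_simp
  have hxa2 : x ^ 2 / 2 = a ^ 2 := by
    rw [hxa, mul_pow, Real.sq_sqrt (by norm_num)]; ring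
  have hz : pole x = a * (1 + I) := pole_eq x
  have hn1 : -(k - a) < 0 := by linarith
  have hn2 : -(k + a) < 0 := by linarith
  have hi1 := integrableOn_exp_mul_Ioi hn1 0
  have hi2 := integrableOn_exp_mul_Ioi hn2 0
  have he1 := integral_exp_mul_Ioi hn1 0
  have he2 := integral_exp_mul_Ioi hn2 0
  rw [mul_zero, Real.exp_zero, neg_div_neg_eq] at he1 he2
  have hval : Real.exp (-(k * c - k ^ 2)) * (2 * x / (k ^ 2 - x ^ 2 / 2)) =
      ∫ s : ℝ in Ioi 0, Real.exp (-(k * c - k ^ 2)) *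
        (√2 * (Real.exp (-(k - a) * s) - Real.exp (-(k + a) * s))) := by
    rw [integral_const_mul, integral_const_mul, integral_sub hi1 hi2, he1, he2, hxa2, hxa]
    congr 1
    have h1 : k - a ≠ 0 := by linarith
    have h2 : k + a ≠ 0 := by linarith
    rw [show k ^ 2 - a ^ 2 = (k - a) * (k + a) by ring]
    field_simp
    ring
  rw [hval, gaussLaplace, gaussLaplace,
    ← integral_sub (integrable_gaussLaplace_integrand _ c).integrableOn
      (integrable_gaussLaplace_integrand _ c).integrableOn]
  refine norm_integral_le_of_norm_le (((hi1.sub hi2).const_mul _).const_mul _) ?_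
  filter_upwards [ae_restrict_mem measurableSet_Ioi] with s hs
  rw [← sub_mul, norm_mul, hz]
  calc _ ≤ √2 * (Real.exp (a * s) - Real.exp (-a * s)) *
        (Real.exp (-(k * c - k ^ 2)) * Real.exp (-k * s)) := by
        have h1 := norm_exp_sub_exp_le ha0.le (le_of_lt hs)
        have h2 := norm_exp_neg_sq_le c k s
        exact mul_le_mul h1 h2 (norm_nonneg _) ((norm_nonneg _).trans h1)
    _ = Real.exp (-(k * c - k ^ 2)) * (√2 * (Real.exp (a * s) * Real.exp (-k * s)
        - Real.exp (-a * s) * Real.exp (-k * s))) := by ring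
    _ = _ := by
      rw [← Real.exp_add, ← Real.exp_add]
      ring_nf

lemma integral_half_mul_exp_neg_sq :
    ∫ s : ℝ in Ioi 0, s / 2 * Real.exp (-(1 / 4) * s ^ 2) = 1 := by
  have h := integral_mul_cexp_neg_mul_sq (b := 1 / 4) (by norm_num)
  have h2 : ∫ s : ℝ in Ioi 0, ((s * Real.exp (-(1 / 4) * s ^ 2) : ℝ) : ℂ) = 2 := by
    rw [show (2 : ℂ) = (2 * (1 / 4) : ℂ)⁻¹ by norm_num, ← h]
    refine integral_congr_ae (Eventually.of_forall fun s => ?_)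
    push_cast
    rfl
  rw [integral_complex_ofReal] at h2
  have h3 : ∫ s : ℝ in Ioi 0, s * Real.exp (-(1 / 4) * s ^ 2) = 2 := by exact_mod_cast h2
  have : ∀ s : ℝ, s / 2 * Real.exp (-(1 / 4) * s ^ 2) =
      1 / 2 * (s * Real.exp (-(1 / 4) * s ^ 2)) := fun s => by ring
  simp_rw [this]
  rw [integral_const_mul, h3]
  norm_num

/-- Integration by parts gives m·J = 1 - ∫(s/2)e^{-ms-s²/4} ds for the integral J, and the last
integral has modulus at most 1. No lower bound on the real part of m beyond 0 is needed. -/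
lemma norm_integral_exp_neg_mul_sub_sq_le {m : ℂ} (hm : 0 ≤ m.re) (hm0 : m ≠ 0) :
    ‖∫ s : ℝ in Ioi 0, cexp (-(m * s) - (s : ℂ) ^ 2 / 4)‖ ≤ 2 / ‖m‖ := by
  have hnorm : ∀ s : ℝ, 0 ≤ s → ‖cexp (-(m * s) - (s : ℂ) ^ 2 / 4)‖ ≤
      Real.exp (-(1 / 4) * s ^ 2) := by
    intro s hs
    rw [Complex.norm_exp, Real.exp_le_exp]
    simp [← ofReal_pow]
    nlinarith [mul_nonneg hm hs]
  have hi : Integrable (fun s : ℝ => cexp (-(m * s) - (s : ℂ) ^ 2 / 4))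
      (volume.restrict (Ioi 0)) := by
    have := integrable_cexp_quadratic' (b := -1 / 4) (by norm_num) (-m) 0
    refine (this.congr (Eventually.of_forall fun s => ?_)).integrableOn
    simp only
    congr 1
    ring
  have hib : Integrable (fun s : ℝ => s / 2 * Real.exp (-(1 / 4) * s ^ 2))
      (volume.restrict (Ioi 0)) := by
    refine (((integrable_mul_exp_neg_mul_sq (b := 1 / 4) (by norm_num)).const_mul
      (1 / 2)).congr (Eventually.of_forall fun s => ?_)).integrableOn
    simp only
    ring
  have hbd : ∀ᵐ s : ℝ ∂volume.restrict (Ioi 0),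
      ‖(s / 2 : ℂ) * cexp (-(m * s) - (s : ℂ) ^ 2 / 4)‖ ≤
        s / 2 * Real.exp (-(1 / 4) * s ^ 2) := by
    filter_upwards [ae_restrict_mem measurableSet_Ioi] with s hs
    have hs0 : 0 < s := hs
    rw [norm_mul, norm_div, Complex.norm_two, norm_real, Real.norm_of_nonneg hs0.le]
    gcongr
    exact hnorm s hs0.le
  have hi2 : Integrable (fun s : ℝ => (s / 2 : ℂ) * cexp (-(m * s) - (s : ℂ) ^ 2 / 4))
      (volume.restrict (Ioi 0)) :=
    hib.mono' (by apply Continuous.aestronglyMeasurable; fun_prop) hbd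
  have hd : ∀ s ∈ Ici (0 : ℝ), HasDerivAt (fun s : ℝ => -cexp (-(m * s) - (s : ℂ) ^ 2 / 4))
      (m * cexp (-(m * s) - (s : ℂ) ^ 2 / 4) +
        (s / 2 : ℂ) * cexp (-(m * s) - (s : ℂ) ^ 2 / 4)) s := by
    intro s _
    have h1 : HasDerivAt (fun s : ℝ => (s : ℂ)) 1 s := Complex.ofRealCLM.hasDerivAt
    have h2 := (((h1.const_mul m).neg.sub ((h1.pow 2).div_const 4)).cexp).neg
    refine h2.congr_deriv ?_
    simp
    ring
  have hlim : Tendsto (fun s : ℝ => -cexp (-(m * s) - (s : ℂ) ^ 2 / 4)) atTop (𝓝 0) := by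
    have h0 : Tendsto (fun u : ℝ => Real.exp (-u)) atTop (𝓝 0) :=
      Real.tendsto_exp_neg_atTop_nhds_zero
    refine squeeze_zero_norm' ((eventually_ge_atTop 4).mono fun s hs => ?_) h0
    rw [norm_neg]
    refine (hnorm s (by linarith)).trans ?_
    rw [Real.exp_le_exp]
    nlinarith
  have hval := integral_Ioi_of_hasDerivAt_of_tendsto' hd ((hi.const_mul m).add hi2) hlim
  rw [integral_add (hi.const_mul m) hi2, integral_const_mul] at hval
  simp only [ofReal_zero, mul_zero, neg_zero, ne_eq, OfNat.ofNat_ne_zero, not_false_eq_true,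
    zero_pow, zero_div, sub_zero, Complex.exp_zero, sub_neg_eq_add, zero_add] at hval
  have hn2 := norm_integral_le_of_norm_le hib hbd
  rw [integral_half_mul_exp_neg_sq] at hn2
  rw [le_div_iff₀ (norm_pos_iff.2 hm0), mul_comm, ← norm_mul, eq_sub_of_add_eq hval]
  refine (norm_sub_le _ _).trans ?_
  rw [norm_one]
  linarith

lemma norm_gaussLaplace_le_two_div {z : ℂ} {c : ℝ} (hre : 0 ≤ c / 2 + z.im)
    (h0 : (c / 2 : ℂ) - I * z ≠ 0) :
    ‖gaussLaplace z c‖ ≤ Real.exp (-c ^ 2 / 4) * (2 / ‖(c / 2 : ℂ) - I * z‖) := by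
  have h : gaussLaplace z c = ((Real.exp (-c ^ 2 / 4) : ℝ) : ℂ) *
      ∫ s : ℝ in Ioi 0, cexp (-(((c / 2 : ℂ) - I * z) * s) - (s : ℂ) ^ 2 / 4) := by
    rw [gaussLaplace, ← integral_const_mul]
    refine integral_congr_ae (Eventually.of_forall fun s => ?_)
    simp only [Complex.ofReal_exp, ← Complex.exp_add]
    congr 1
    push_cast
    ring
  rw [h, norm_mul, norm_real, Real.norm_of_nonneg (Real.exp_pos _).le]
  gcongr
  refine norm_integral_exp_neg_mul_sub_sq_le ?_ h0
  have : ((c / 2 : ℂ) - I * z).re = c / 2 + z.im := by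
    rw [show (c / 2 : ℂ) = ((c / 2 : ℝ) : ℂ) by push_cast; rfl]
    simp [-ofReal_div]
  rwa [this]

/-! ### Poisson summation for the midpoint rule -/

lemma norm_integrand_le {x t : ℝ} (hx : 0 < x) (ht : t ≠ 0) :
    ‖integrand x t‖ ≤ x / (2 * Real.pi) * (t ^ 2)⁻¹ := by
  have hpi := Real.pi_pos
  have ht2 : 0 < t ^ 2 := by positivity
  have h1 : ‖cexp (I * ((x : ℂ) ^ 2 + Real.pi / 4))‖ = 1 := by
    rw [show I * ((x : ℂ) ^ 2 + Real.pi / 4) = ((x ^ 2 + Real.pi / 4 : ℝ) : ℂ) * I by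
      push_cast; ring, norm_exp_ofReal_mul_I]
  have h2 : ‖(x : ℂ) / (2 * Real.pi)‖ = x / (2 * Real.pi) := by
    rw [show (x : ℂ) / (2 * Real.pi) = ((x / (2 * Real.pi) : ℝ) : ℂ) by push_cast; rfl, norm_real,
      Real.norm_of_nonneg (by positivity)]
  have h3 : ‖cexp (-(t : ℂ) ^ 2)‖ ≤ 1 := by
    rw [show -(t : ℂ) ^ 2 = ((-t ^ 2 : ℝ) : ℂ) by push_cast; rfl, ← ofReal_exp, norm_real,
      Real.norm_of_nonneg (Real.exp_pos _).le, Real.exp_le_one_iff]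
    linarith
  have h4 : t ^ 2 ≤ ‖(x : ℂ) ^ 2 + I * t ^ 2‖ := by
    have := abs_im_le_norm ((x : ℂ) ^ 2 + I * t ^ 2)
    rw [show (x : ℂ) ^ 2 + I * t ^ 2 = ((x ^ 2 : ℝ) : ℂ) + (t ^ 2 : ℝ) * I by push_cast; ring]
      at this ⊢
    simp only [add_im, ofReal_im, im_ofReal_mul, I_im, mul_one, zero_add] at this
    exact (le_abs_self _).trans this
  rw [integrand, norm_mul, norm_mul, h1, h2, one_mul, norm_div, ← one_div]
  gcongr

lemma half_abs_le_abs_sub_half (k : ℤ) : |(k : ℝ)| / 2 ≤ |(k : ℝ) - 1 / 2| := by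
  rcases le_or_gt k 0 with hk | hk
  · have h : (k : ℝ) ≤ 0 := by exact_mod_cast hk
    rw [abs_of_nonpos h, abs_of_neg (by linarith)]
    linarith
  · have h : (1 : ℝ) ≤ k := by exact_mod_cast hk
    rw [abs_of_pos (by linarith), abs_of_pos (by linarith)]
    linarith

lemma summable_integrand_node {h x : ℝ} (hh : 0 < h) (hx : 0 < x) :
    Summable (fun k : ℤ => integrand x (node h k)) := by
  have hs : Summable fun k : ℤ => x / (2 * Real.pi) * ((4 / h ^ 2) * (1 / (k : ℝ) ^ 2)) :=
    ((Real.summable_one_div_int_pow.2 (by norm_num)).mul_left _).mul_left _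
  refine Summable.of_norm_bounded_eventually hs ?_
  have : ∀ᶠ k : ℤ in cofinite, k ≠ 0 := eventually_cofinite_ne 0
  filter_upwards [this] with k hk
  have hk0 : (k : ℝ) ≠ 0 := by exact_mod_cast hk
  have hk2 : 0 < (k : ℝ) ^ 2 := by positivity
  have hle : (k : ℝ) ^ 2 / 4 ≤ ((k : ℝ) - 1 / 2) ^ 2 := by
    have := half_abs_le_abs_sub_half k
    rw [← sq_abs ((k : ℝ) - 1 / 2), ← sq_abs (k : ℝ)]
    nlinarith [abs_nonneg (k : ℝ)]
  have hn : 0 < (node h k) ^ 2 := by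
    rw [node, mul_pow]
    have : 0 < ((k : ℝ) - 1 / 2) ^ 2 := by linarith
    positivity
  refine (norm_integrand_le hx (fun h0 => by rw [h0] at hn; simp at hn)).trans ?_
  have hpi := Real.pi_pos
  gcongr
  rw [show 4 / h ^ 2 * (1 / (k : ℝ) ^ 2) = ((k : ℝ) ^ 2 / 4 * h ^ 2)⁻¹ by field_simp, node, mul_pow]
  gcongr

lemma continuous_integrand {x : ℝ} (hx : 0 < x) : Continuous (integrand x) := by
  have h0 : ∀ t : ℝ, (x : ℂ) ^ 2 + I * (t : ℂ) ^ 2 ≠ 0 := by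
    intro t h
    have := congrArg Complex.re h
    rw [show (x : ℂ) ^ 2 + I * t ^ 2 = ((x ^ 2 : ℝ) : ℂ) + (t ^ 2 : ℝ) * I by push_cast; ring]
      at this
    simp only [add_re, ofReal_re, re_ofReal_mul, I_re, mul_zero, add_zero, zero_re] at this
    exact (pow_pos hx 2).ne' this
  unfold integrand
  exact continuous_const.mul (Continuous.div (by fun_prop) (by fun_prop) h0)

lemma isBigO_integrand {h x : ℝ} (hh : 0 < h) (hx : 0 < x) :
    (fun u : ℝ => integrand x (u * h)) =O[cocompact ℝ] fun u : ℝ => |u| ^ (-2 : ℝ) := by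
  refine Asymptotics.IsBigO.of_bound (x / (2 * Real.pi) * (h ^ 2)⁻¹) ?_
  have : ∀ᶠ u : ℝ in cocompact ℝ, u ≠ 0 := by
    have := (isCompact_singleton (x := (0 : ℝ))).compl_mem_cocompact
    filter_upwards [this] with u hu using hu
  filter_upwards [this] with u hu
  refine (norm_integrand_le hx (mul_ne_zero hu hh.ne')).trans (le_of_eq ?_)
  rw [Real.norm_of_nonneg (by positivity), Real.rpow_neg (abs_nonneg u),
    show (2 : ℝ) = ((2 : ℕ) : ℝ) by norm_num, Real.rpow_natCast, sq_abs, mul_pow, mul_inv]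
  push_cast
  ring

lemma fourier_integrand {h : ℝ} (hh : 0 < h) {x : ℝ} (hx : 0 < x) (n : ℤ) :
    (h : ℂ) * FourierTransform.fourier (fun u : ℝ => integrand x (u * h)) (n : ℝ) =
      fourierAt x (n * (2 * Real.pi / h)) := by
  -- The Fourier kernel has the opposite sign to `fourierAt`; evenness in c absorbs it.
  rw [← fourierAt_neg hx, Real.fourier_real_eq_integral_exp_smul, fourierAt]
  have := Measure.integral_comp_mul_right (fun t : ℝ =>
    cexp (I * (-((n : ℝ) * (2 * Real.pi / h)) : ℝ) * t) * integrand x t) h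
  have h0 : (h : ℂ) ≠ 0 := by exact_mod_cast hh.ne'
  rw [abs_of_pos (inv_pos.2 hh), Complex.real_smul, ofReal_inv] at this
  rw [← mul_right_inj' (inv_ne_zero h0), ← this, inv_mul_cancel_left₀ h0]
  refine integral_congr_ae (Eventually.of_forall fun s => ?_)
  simp only [smul_eq_mul]
  congr 2
  push_cast
  field_simp

/-- Exponential decay makes the dual series summable. The rate a/2 is a convenient choice strictly
between 0 and the height a of the pole. -/
lemma norm_fourierAt_le {x : ℝ} (hx : 0 < x) :
    ∃ K r : ℝ, 0 ≤ K ∧ 0 < r ∧ ∀ c : ℝ, ‖fourierAt x c‖ ≤ K * Real.exp (-(r * |c|)) := by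
  set a := x / √2 with ha
  have ha0 : 0 < a := by positivity
  have ha1 : 0 < a + -(a / 2) := by linarith
  set K : ℝ := ‖cexp (I * x ^ 2) / (4 * √Real.pi)‖ * (Real.exp ((a / 2) ^ 2) / (a + a / 2) +
    Real.exp ((a / 2) ^ 2) / (a + -(a / 2))) with hK
  have hpos : ∀ c : ℝ, 0 ≤ c → ‖fourierAt x c‖ ≤ K * Real.exp (-((a / 2) * c)) := by
    intro c _
    have h1 := norm_gaussLaplace_le (z := pole x) c (k := a / 2) (by rw [pole_im, ← ha]; linarith)
    have h2 := norm_gaussLaplace_le (z := pole x) (-c) (k := -(a / 2))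
      (by rw [pole_im, ← ha]; linarith)
    rw [pole_im, ← ha] at h1 h2
    rw [(integrable_exp_mul_integrand hx c).2, norm_mul, hK, mul_assoc]
    gcongr
    refine (norm_add_le _ _).trans ((add_le_add h1 h2).trans (le_of_eq ?_))
    rw [show -(a / 2 * c - (a / 2) ^ 2) = (a / 2) ^ 2 + -(a / 2 * c) by ring,
      show -(-(a / 2) * -c - (-(a / 2)) ^ 2) = (a / 2) ^ 2 + -(a / 2 * c) by ring, Real.exp_add]
    ring
  refine ⟨K, a / 2, by positivity, by positivity, fun c => ?_⟩
  rcases le_total 0 c with hc | hc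
  · rw [abs_of_nonneg hc]; exact hpos c hc
  · rw [abs_of_nonpos hc, ← fourierAt_neg hx]; exact hpos (-c) (by linarith)

lemma summable_fourierAt {h x : ℝ} (hh : 0 < h) (hx : 0 < x) :
    Summable (fun n : ℤ => fourierAt x (n * (2 * Real.pi / h))) := by
  obtain ⟨K, r, hK, hr, hb⟩ := norm_fourierAt_le hx
  have hpi := Real.pi_pos
  have hneg : -(r * (2 * Real.pi / h)) < 0 := neg_neg_of_pos (by positivity)
  have hs : Summable fun n : ℕ => K * Real.exp (n * -(r * (2 * Real.pi / h))) :=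
    (Real.summable_exp_nat_mul_iff.2 hneg).mul_left K
  refine Summable.of_nat_of_neg (Summable.of_norm_bounded hs fun n => ?_)
    (Summable.of_norm_bounded hs fun n => ?_)
  all_goals
    refine (hb _).trans (le_of_eq ?_)
    congr 2
    rw [abs_mul, abs_of_pos (by positivity : 0 < 2 * Real.pi / h)]
    simp
    ring

lemma trapezium_eq {h x : ℝ} (hh : 0 < h) (hx : 0 < x) :
    trapezium h x = fourierAt x 0 +
      2 * ∑' n : ℕ, (-1 : ℂ) ^ (n + 1) * fourierAt x ((n + 1 : ℕ) * (2 * Real.pi / h)) := by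
  have h0 : (h : ℂ) ≠ 0 := by exact_mod_cast hh.ne'
  have hF : ∀ n : ℤ, FourierTransform.fourier (fun u : ℝ => integrand x (u * h)) (n : ℝ) =
      (h : ℂ)⁻¹ * fourierAt x (n * (2 * Real.pi / h)) := fun n => by
    rw [← fourier_integrand hh hx, inv_mul_cancel_left₀ h0]
  have hP := Real.tsum_eq_tsum_fourier_of_rpow_decay_of_summable (b := 2)
    (f := fun u : ℝ => integrand x (u * h))
    ((continuous_integrand hx).comp (continuous_id.mul continuous_const)) (by norm_num)
    (isBigO_integrand hh hx)
    (by simp_rw [hF]; exact (summable_fourierAt hh hx).mul_left _) (-1 / 2)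
  -- The half-step shift of the nodes enters as the character at -1/2 and produces the alternating
  -- signs.
  have hsign : ∀ n : ℤ, (fourier n ((-1 / 2 : ℝ) : UnitAddCircle) : ℂ) = (-1) ^ n := by
    intro n
    rw [fourier_coe_apply, ← Complex.exp_neg_pi_mul_I, ← Complex.exp_int_mul]
    congr 1
    push_cast
    ring
  simp_rw [hF, hsign] at hP
  have h1 : trapezium h x =
      ∑' n : ℤ, (-1 : ℂ) ^ n * fourierAt x (n * (2 * Real.pi / h)) := by
    rw [trapezium, show (∑' k : ℤ, integrand x (node h k)) =
        ∑' n : ℤ, integrand x ((-1 / 2 + (n : ℝ)) * h) from tsum_congr fun k => by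
          rw [node]; congr 2; ring, hP, ← tsum_mul_left]
    refine tsum_congr fun n => ?_
    field_simp
  rw [h1, tsum_int_eq_zero_add_two_mul_tsum_pnat,
    tsum_pnat_eq_tsum_succ (f := fun n : ℕ =>
      (-1 : ℂ) ^ (n : ℤ) * fourierAt x ((n : ℤ) * (2 * Real.pi / h)))]
  · simp only [zpow_zero, one_mul, Int.cast_zero, zero_mul, zpow_natCast, Int.cast_natCast,
      nsmul_eq_mul, Nat.cast_ofNat]
  · intro n
    simp only [Int.cast_neg, neg_mul, fourierAt_neg hx]
    congr 1
    rw [zpow_neg, ← inv_zpow, inv_neg, inv_one]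
  · refine ((summable_fourierAt hh hx).norm).of_norm_bounded fun n => ?_
    rw [norm_mul, norm_zpow, norm_neg, norm_one, one_zpow, one_mul]

/-! ### The pole correction as a geometric series -/

/-- The nome `e^{2πi z/h}` at the pole `z` of the integrand. -/
def nome (h x : ℝ) : ℂ := cexp (I * (2 * Real.pi / h : ℝ) * pole x)

lemma norm_nome (h x : ℝ) : ‖nome h x‖ = Real.exp (-(√2 * Real.pi * x / h)) := by
  rw [nome, norm_exp_I_mul, pole_im, div_sqrt_two]
  congr 1
  ring

lemma norm_nome_lt_one {h x : ℝ} (hh : 0 < h) (hx : 0 < x) : ‖nome h x‖ < 1 := by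
  rw [norm_nome, Real.exp_lt_one_iff, neg_lt_zero]
  have := Real.pi_pos
  positivity

/-- With w = πz/h and q = e^{2iw}, one has 1 + i tan w = 2q/(1+q). -/
lemma poleCorrection_eq {h x : ℝ} (hh : 0 < h) (hx : 0 < x) :
    poleCorrection h x = nome h x / (1 + nome h x) := by
  set w : ℂ := cexp (I * Real.pi / 4) * x * Real.pi / h with hw
  have hq : nome h x = cexp (w * I) * cexp (w * I) := by
    rw [nome, ← Complex.exp_add, hw, pole]
    congr 1
    push_cast
    ring
  have h1 : 1 + cexp (w * I) * cexp (w * I) ≠ 0 := by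
    intro h0
    have h2 := norm_nome_lt_one hh hx
    rw [hq, eq_neg_of_add_eq_zero_right h0, norm_neg, norm_one] at h2
    exact lt_irrefl _ h2
  have he := Complex.exp_ne_zero (w * I)
  rw [poleCorrection, ← hw, Complex.tan, Complex.sin, Complex.cos, hq, neg_mul, Complex.exp_neg]
  generalize cexp (w * I) = e at *
  have h2 : 1 + e ^ 2 ≠ 0 := by rwa [sq]
  rw [show e⁻¹ - e = (1 - e ^ 2) / e by field_simp, show e + e⁻¹ = (1 + e ^ 2) / e by
    field_simp; ring]
  field_simp
  rw [I_sq]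
  ring

lemma norm_poleCorrection_le {h x : ℝ} (hh : 0 < h) (hx : 0 < x) :
    ‖poleCorrection h x‖ ≤ Real.exp (-(√2 * Real.pi * x / h)) /
      (1 - Real.exp (-(√2 * Real.pi * x / h))) := by
  rw [poleCorrection_eq hh hx, norm_div, ← norm_nome]
  have := norm_nome_lt_one hh hx
  have h1 : 1 - ‖nome h x‖ ≤ ‖1 + nome h x‖ := by
    have := norm_sub_norm_le (1 : ℂ) (-nome h x)
    rwa [norm_one, norm_neg, sub_neg_eq_add] at this
  gcongr

lemma hasSum_poleCorrection {h x : ℝ} (hh : 0 < h) (hx : 0 < x) :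
    HasSum (fun n : ℕ => (-1 : ℂ) ^ (n + 1) * nome h x ^ (n + 1)) (-poleCorrection h x) := by
  have h1 := (hasSum_geometric_of_norm_lt_one (ξ := -nome h x)
    (by rw [norm_neg]; exact norm_nome_lt_one hh hx)).mul_left (-nome h x)
  rw [poleCorrection_eq hh hx]
  have h2 : (fun n : ℕ => (-1 : ℂ) ^ (n + 1) * nome h x ^ (n + 1)) =
      fun n => -nome h x * (-nome h x) ^ n := by
    funext n
    rw [← mul_pow, pow_succ]
    ring
  rw [h2, ← neg_div, div_eq_mul_inv, ← sub_neg_eq_add 1 (nome h x)]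
  exact h1

lemma norm_two_mul_tsum_le {r B : ℝ} (hr0 : 0 ≤ r) (hr : r < 1) {u : ℕ → ℂ}
    (hu : ∀ n, ‖u n‖ ≤ B * r ^ n) :
    ‖2 * ∑' n : ℕ, (-1 : ℂ) ^ (n + 1) * u n‖ ≤ 2 * B / (1 - r) := by
  rw [norm_mul, Complex.norm_two, mul_div_assoc, div_eq_mul_inv B]
  gcongr
  refine tsum_of_norm_bounded ((hasSum_geometric_of_lt_one hr0 hr).mul_left B) fun n => ?_
  rw [norm_mul, norm_pow, norm_neg, norm_one, one_pow, one_mul]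
  exact hu n

lemma summable_fourierAt_nat {h x : ℝ} (hh : 0 < h) (hx : 0 < x) :
    Summable fun n : ℕ => (-1 : ℂ) ^ (n + 1) * fourierAt x ((n + 1 : ℕ) * (2 * Real.pi / h)) := by
  have h1 : Summable fun n : ℕ => fourierAt x ((n + 1 : ℕ) * (2 * Real.pi / h)) := by
    have := (summable_fourierAt hh hx).comp_injective
      (i := fun n : ℕ => ((n + 1 : ℕ) : ℤ)) (fun a b hab => by simpa using hab)
    simpa [Function.comp_def] using this
  refine h1.norm.of_norm_bounded fun n => ?_
  rw [norm_mul, norm_pow, norm_neg, norm_one, one_pow, one_mul]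

lemma norm_sub_trapezium_le {h x r B : ℝ} (hh : 0 < h) (hx : 0 < x) (hr0 : 0 ≤ r) (hr : r < 1)
    (hu : ∀ n : ℕ, ‖fourierAt x ((n + 1 : ℕ) * (2 * Real.pi / h))‖ ≤ B * r ^ n) :
    ‖fresnelF x - trapezium h x‖ ≤ 2 * B / (1 - r) := by
  rw [fresnelF_eq hx, trapezium_eq hh hx, sub_add_cancel_left, norm_neg]
  exact norm_two_mul_tsum_le hr0 hr hu

/-- The correction is absorbed term by term, so that a geometric bound on the remainders suffices.
-/
lemma norm_sub_modifiedTrapezium_le {h x r B : ℝ} (hh : 0 < h) (hx : 0 < x) (hr0 : 0 ≤ r)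
    (hr : r < 1)
    (hu : ∀ n : ℕ, ‖fourierAt x ((n + 1 : ℕ) * (2 * Real.pi / h)) - 1 / 2 * nome h x ^ (n + 1)‖ ≤
      B * r ^ n) :
    ‖fresnelF x - modifiedTrapezium h x‖ ≤ 2 * B / (1 - r) := by
  have h1 : fresnelF x - modifiedTrapezium h x = -(2 * ∑' n : ℕ, (-1 : ℂ) ^ (n + 1) *
      (fourierAt x ((n + 1 : ℕ) * (2 * Real.pi / h)) - 1 / 2 * nome h x ^ (n + 1))) := by
    have h2 := (summable_fourierAt_nat hh hx).hasSum.sub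
      ((hasSum_poleCorrection hh hx).mul_left (1 / 2))
    have h3 : (∑' n : ℕ, (-1 : ℂ) ^ (n + 1) *
        (fourierAt x ((n + 1 : ℕ) * (2 * Real.pi / h)) - 1 / 2 * nome h x ^ (n + 1))) =
        (∑' n : ℕ, (-1 : ℂ) ^ (n + 1) * fourierAt x ((n + 1 : ℕ) * (2 * Real.pi / h))) -
          1 / 2 * -poleCorrection h x := by
      rw [← h2.tsum_eq]
      exact tsum_congr fun n => by ring
    rw [h3, modifiedTrapezium, fresnelF_eq hx, trapezium_eq hh hx]
    ring
  rw [h1, norm_neg]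
  exact norm_two_mul_tsum_le hr0 hr hu

/-! ### The three error bounds -/

lemma norm_prefactor (x : ℝ) : ‖cexp (I * (x : ℂ) ^ 2) / (4 * √Real.pi)‖ = 1 / (4 * √Real.pi) := by
  rw [norm_div, show I * (x : ℂ) ^ 2 = ((x ^ 2 : ℝ) : ℂ) * I by push_cast; ring,
    norm_exp_ofReal_mul_I, norm_mul, norm_real, Real.norm_of_nonneg (Real.sqrt_nonneg _)]
  norm_num

/-- The rate π/h is optimal for the first frequency 2π/h. Keeping it for every n makes the bounds a
geometric sequence. -/
lemma exp_neg_shift (h : ℝ) (n : ℕ) :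
    Real.exp (-(Real.pi / h * ((n + 1 : ℕ) * (2 * Real.pi / h)) - (Real.pi / h) ^ 2)) =
      Real.exp (-(Real.pi ^ 2 / h ^ 2)) * Real.exp (-(2 * Real.pi ^ 2 / h ^ 2)) ^ n := by
  rw [← Real.exp_nat_mul, ← Real.exp_add]
  congr 1
  push_cast
  ring

lemma nome_pow (h x : ℝ) (n : ℕ) :
    nome h x ^ (n + 1) = cexp (I * ((n + 1 : ℕ) * (2 * Real.pi / h) : ℝ) * pole x) := by
  rw [nome, ← Complex.exp_nat_mul]
  congr 1
  push_cast
  ring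

lemma norm_fourierAt_sub_le {x : ℝ} (hx : 0 < x) (h : ℝ) (n : ℕ) {b : ℝ}
    (hb : ‖gaussLaplace (pole x) ((n + 1 : ℕ) * (2 * Real.pi / h)) -
      gaussLaplace (-pole x) ((n + 1 : ℕ) * (2 * Real.pi / h))‖ ≤ b) :
    ‖fourierAt x ((n + 1 : ℕ) * (2 * Real.pi / h)) - 1 / 2 * nome h x ^ (n + 1)‖ ≤
      1 / (4 * √Real.pi) * b := by
  rw [fourierAt_eq hx, nome_pow, add_sub_cancel_left, norm_mul, norm_prefactor]
  gcongr

lemma norm_fourierAt_le_of {x : ℝ} (hx : 0 < x) (c : ℝ) {b : ℝ}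
    (hb : ‖gaussLaplace (pole x) c + gaussLaplace (pole x) (-c)‖ ≤ b) :
    ‖fourierAt x c‖ ≤ 1 / (4 * √Real.pi) * b := by
  rw [(integrable_exp_mul_integrand hx c).2, norm_mul, norm_prefactor]
  gcongr

lemma exp_neg_pi_lt_one {h : ℝ} (hh : 0 < h) : Real.exp (-(2 * Real.pi ^ 2 / h ^ 2)) < 1 := by
  rw [Real.exp_lt_one_iff, neg_lt_zero]
  have := Real.pi_pos
  positivity

lemma sq_div_two_eq (x : ℝ) : x ^ 2 / 2 = (x / √2) ^ 2 := by
  rw [div_pow, Real.sq_sqrt (by norm_num)]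

lemma div_sqrt_two_le {x : ℝ} (hx : 0 < x) : x / √2 ≤ x :=
  div_le_self hx.le (Real.one_le_sqrt.2 (by norm_num))

lemma error_le_delta1 {h x : ℝ} (hh : 0 < h) (hx : 0 < x) (hlt : x / √2 < Real.pi / h) :
    ‖fresnelF x - modifiedTrapezium h x‖ ≤ delta1 h x := by
  have hpi := Real.pi_pos
  have hr := exp_neg_pi_lt_one hh
  have hpos : 0 < (Real.pi / h) ^ 2 - x ^ 2 / 2 := by
    rw [sq_div_two_eq, sub_pos]
    gcongr
  refine (norm_sub_modifiedTrapezium_le hh hx (Real.exp_pos _).le hr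
    (B := 1 / (4 * √Real.pi) * (Real.exp (-(Real.pi ^ 2 / h ^ 2)) *
      (2 * x / ((Real.pi / h) ^ 2 - x ^ 2 / 2)))) fun n => ?_).trans (le_of_eq ?_)
  · have := norm_gaussLaplace_sub_le hx ((n + 1 : ℕ) * (2 * Real.pi / h)) hlt
    rw [exp_neg_shift] at this
    refine (norm_fourierAt_sub_le hx h n this).trans (le_of_eq ?_)
    ring
  · rw [div_pow] at hpos ⊢
    rw [delta1, abs_of_pos hpos]
    have h1 : 1 - Real.exp (-(2 * Real.pi ^ 2 / h ^ 2)) ≠ 0 := by linarith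
    have h2 : 0 < √Real.pi := Real.sqrt_pos.2 hpi
    field_simp
    ring

lemma error_le_delta3 {h x : ℝ} (hh : 0 < h) (hx : 0 < x) (hlt : Real.pi / h < x / √2) :
    ‖fresnelF x - modifiedTrapezium h x‖ ≤ delta3 h x := by
  have hpi := Real.pi_pos
  have hr := exp_neg_pi_lt_one hh
  have hH : 0 < Real.pi / h := by positivity
  set a := x / √2 with ha
  have hneg : 0 < a ^ 2 - (Real.pi / h) ^ 2 := by
    rw [sub_pos]
    gcongr
  have h2 : 0 < √Real.pi := Real.sqrt_pos.2 hpi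
  have h3 : 0 < 1 - Real.exp (-(2 * Real.pi ^ 2 / h ^ 2)) := by linarith
  have htrap : ‖fresnelF x - trapezium h x‖ ≤ delta1 h x := by
    refine (norm_sub_trapezium_le hh hx (Real.exp_pos _).le hr
      (B := 1 / (4 * √Real.pi) * (Real.exp (-(Real.pi ^ 2 / h ^ 2)) *
        (1 / (a + Real.pi / h) + 1 / (a + -(Real.pi / h))))) fun n => ?_).trans ?_
    · have h4 := norm_gaussLaplace_le (z := pole x) ((n + 1 : ℕ) * (2 * Real.pi / h))
        (k := Real.pi / h) (by rw [pole_im]; linarith)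
      have h5 := norm_gaussLaplace_le (z := pole x) (-((n + 1 : ℕ) * (2 * Real.pi / h)))
        (k := -(Real.pi / h)) (by rw [pole_im]; linarith)
      rw [neg_mul_neg, neg_sq] at h5
      rw [exp_neg_shift, pole_im, ← ha] at h4 h5
      refine (norm_fourierAt_le_of hx _ ((norm_add_le _ _).trans (add_le_add h4 h5))).trans
        (le_of_eq ?_)
      ring
    · have h6 : 0 < a + Real.pi / h := by linarith
      have h7 : 0 < a + -(Real.pi / h) := by linarith
      have h8 : 1 / (a + Real.pi / h) + 1 / (a + -(Real.pi / h)) =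
          2 * a / (a ^ 2 - (Real.pi / h) ^ 2) := by
        rw [div_add_div _ _ h6.ne' h7.ne']
        congr 1 <;> ring
      have h9 : |Real.pi ^ 2 / h ^ 2 - x ^ 2 / 2| = a ^ 2 - (Real.pi / h) ^ 2 := by
        rw [sq_div_two_eq, ← div_pow, ← ha, abs_of_neg (by linarith)]
        ring
      rw [delta1, h9, h8]
      -- The sum of the two fractions yields δ₁ with a in place of x in the numerator; a factor √2
      -- is given away.
      have hax : a ≤ x := div_sqrt_two_le hx
      calc _ = a * Real.exp (-(Real.pi ^ 2 / h ^ 2)) / (√Real.pi * (a ^ 2 - (Real.pi / h) ^ 2) *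
            (1 - Real.exp (-(2 * Real.pi ^ 2 / h ^ 2)))) := by
            field_simp
            ring
        _ ≤ _ := by gcongr
  rw [delta3, modifiedTrapezium, ← sub_sub]
  exact (norm_sub_le _ _).trans (add_le_add htrap (norm_poleCorrection_le hh hx))

lemma exp_neg_sq_le (h : ℝ) (n : ℕ) :
    Real.exp (-((n + 1 : ℕ) * (2 * Real.pi / h)) ^ 2 / 4) ≤
      Real.exp (-(Real.pi ^ 2 / h ^ 2)) * Real.exp (-(2 * Real.pi ^ 2 / h ^ 2)) ^ n := by
  rw [← exp_neg_shift, Real.exp_le_exp]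
  have : (0 : ℝ) ≤ (((n + 1 : ℕ) * (2 * Real.pi / h)) / 2 - Real.pi / h) ^ 2 := sq_nonneg _
  nlinarith

/-- The imaginary part of c/2 - iz is ±a whatever c is, so the denominator stays away from 0 even
when the real part vanishes. -/
lemma norm_gaussLaplace_le_div_im {x c : ℝ} (hx : 0 < x) {z : ℂ}
    (hz : z = pole x ∨ z = -pole x) (hre : 0 ≤ c / 2 + z.im) :
    ‖gaussLaplace z c‖ ≤ Real.exp (-c ^ 2 / 4) * (2 / (x / √2)) := by
  have ha : 0 < x / √2 := by positivity
  have h1 : x / √2 ≤ ‖(c / 2 : ℂ) - I * z‖ := by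
    refine le_trans (le_of_eq ?_) (abs_im_le_norm _)
    rw [show (c / 2 : ℂ) = ((c / 2 : ℝ) : ℂ) by push_cast; rfl, sub_im, ofReal_im, zero_sub,
      abs_neg, I_mul_im]
    rcases hz with rfl | rfl
    · rw [pole_re, abs_of_pos ha]
    · rw [neg_re, abs_neg, pole_re, abs_of_pos ha]
  refine (norm_gaussLaplace_le_two_div hre (norm_pos_iff.1 (ha.trans_le h1))).trans ?_
  gcongr

/-- Near the pole, the remainders decay geometrically with a constant that stays bounded. -/
lemma norm_fourierAt_sub_le_near {h x : ℝ} (hh : 0 < h) (hx : 0 < x)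
    (hlt : x / √2 < 2 * (Real.pi / h)) (n : ℕ) :
    ‖fourierAt x ((n + 1 : ℕ) * (2 * Real.pi / h)) - 1 / 2 * nome h x ^ (n + 1)‖ ≤
      (1 / (4 * √Real.pi) * (Real.exp (-(Real.pi ^ 2 / h ^ 2)) *
        (1 / (x / √2 + Real.pi / h) + 2 / (x / √2))) +
        1 / 2 * Real.exp (-(2 * Real.pi ^ 2 / h ^ 2))) *
        Real.exp (-(2 * Real.pi ^ 2 / h ^ 2)) ^ n := by
  have hpi := Real.pi_pos
  have h2 : 0 < √Real.pi := Real.sqrt_pos.2 hpi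
  have hH : 0 < Real.pi / h := by positivity
  have ha : 0 < x / √2 := by positivity
  set c : ℝ := (n + 1 : ℕ) * (2 * Real.pi / h) with hc
  have hc2 : c / 2 = (n + 1) * (Real.pi / h) := by rw [hc]; push_cast; ring
  set e := Real.exp (-(Real.pi ^ 2 / h ^ 2))
  set r := Real.exp (-(2 * Real.pi ^ 2 / h ^ 2)) with hr
  have he0 : 0 < e := Real.exp_pos _
  have hr0 : 0 < r := Real.exp_pos _
  have h4 : ‖gaussLaplace (pole x) c‖ ≤ e * r ^ n / (x / √2 + Real.pi / h) := by
    have := norm_gaussLaplace_le (z := pole x) c (k := Real.pi / h) (by rw [pole_im]; linarith)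
    rwa [hc, exp_neg_shift, pole_im] at this
  have hsq := exp_neg_sq_le h n
  rw [← hc] at hsq
  -- The sign of c/2 - a decides which transform can be integrated by parts: that at (-z, c), or
  -- that at (z, -c) with the residue left unsubtracted.
  rcases le_or_gt (x / √2) (c / 2) with hle | hgt
  · have h5 := norm_gaussLaplace_le_div_im (c := c) hx (Or.inr rfl)
      (by rw [neg_im, pole_im]; linarith)
    have h6 : ‖gaussLaplace (-pole x) c‖ ≤ e * r ^ n * (2 / (x / √2)) := h5.trans (by gcongr)
    refine (norm_fourierAt_sub_le hx h n ((norm_sub_le _ _).trans (add_le_add h4 h6))).trans ?_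
    have : 0 ≤ 1 / 2 * r * r ^ n := by positivity
    calc _ = 1 / (4 * √Real.pi) * (e * (1 / (x / √2 + Real.pi / h) + 2 / (x / √2))) * r ^ n := by
          ring
      _ ≤ _ := by rw [add_mul]; linarith
  -- As a < 2H, only the first frequency can lie below the pole.
  · have hn : n = 0 := by
      by_contra hn
      have h7 : (1 : ℝ) ≤ n := by exact_mod_cast Nat.one_le_iff_ne_zero.2 hn
      rw [hc2] at hgt
      nlinarith
    have hcH : c / 2 = Real.pi / h := by rw [hc2, hn]; simp
    have h5 := norm_gaussLaplace_le_div_im (c := -c) hx (Or.inl rfl)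
      (by rw [pole_im]; linarith)
    rw [neg_sq] at h5
    have h6 : ‖gaussLaplace (pole x) (-c)‖ ≤ e * r ^ n * (2 / (x / √2)) := h5.trans (by gcongr)
    have h7 := norm_fourierAt_le_of hx c ((norm_add_le _ _).trans (add_le_add h4 h6))
    -- Here a > H, so the residue has modulus e^{-2aH} ≤ e^{-2H²}.
    have h8 : ‖nome h x ^ (n + 1)‖ ≤ r := by
      rw [hn, zero_add, pow_one, nome, norm_exp_I_mul, pole_im, hr, Real.exp_le_exp]
      rw [hcH] at hgt
      have h9 := mul_le_mul_of_nonneg_right hgt.le (by positivity : 0 ≤ 2 * (Real.pi / h))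
      calc _ = -(x / √2 * (2 * (Real.pi / h))) := by ring
        _ ≤ -(Real.pi / h * (2 * (Real.pi / h))) := neg_le_neg h9
        _ = _ := by ring
    refine (norm_sub_le _ _).trans ?_
    have h10 : ‖(1 / 2 : ℂ) * nome h x ^ (n + 1)‖ ≤ 1 / 2 * r := by
      rw [norm_mul, show ‖(1 / 2 : ℂ)‖ = 1 / 2 by norm_num]
      linarith
    refine (add_le_add h7 h10).trans (le_of_eq ?_)
    rw [hn]
    ring

lemma abs_beta_sub_lt : |beta - 0.0536| < 0.00005 := by
  have h1 : (1.41421 : ℝ) < √2 := Real.lt_sqrt_of_sq_lt (by norm_num)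
  have h2 : √2 < (1.41422 : ℝ) := by rw [Real.sqrt_lt' (by norm_num)]; norm_num
  rw [beta, abs_lt]
  constructor <;> norm_num at * <;> linarith

lemma error_le_delta2 {h x : ℝ} (hh : 0 < h) (hx : 0 < x)
    (hl : 3 / 4 * (Real.pi / h) < x / √2) (hu : x / √2 < 5 / 4 * (Real.pi / h)) :
    ‖fresnelF x - modifiedTrapezium h x‖ ≤ delta2 h x := by
  have hpi := Real.pi_pos
  have h2 : 0 < √Real.pi := Real.sqrt_pos.2 hpi
  have hr := exp_neg_pi_lt_one hh
  have hH : 0 < Real.pi / h := by positivity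
  refine (norm_sub_modifiedTrapezium_le hh hx (Real.exp_pos _).le hr
    (norm_fourierAt_sub_le_near hh hx (by linarith))).trans ?_
  have hsqrt : (1.4 : ℝ) < √2 := Real.lt_sqrt_of_sq_lt (by norm_num)
  have hx2 : x = √2 * (x / √2) := by field_simp
  set a := x / √2 with ha
  set H := Real.pi / h with hHdef
  have ha0 : 0 < a := by positivity
  have hexp : Real.exp (-(2 * Real.pi ^ 2 / h ^ 2)) = Real.exp (-(Real.pi ^ 2 / h ^ 2)) *
      Real.exp (-H ^ 2) := by
    rw [← Real.exp_add, hHdef]; congr 1; ring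
  have hd2 : delta2 h x = Real.exp (-(Real.pi ^ 2 / h ^ 2)) *
      (4 * x / (√Real.pi * H * (H + a)) * (1 + 2 * √Real.pi * Real.exp (-(beta * H ^ 2)))) /
      (1 - Real.exp (-(2 * Real.pi ^ 2 / h ^ 2))) := by
    rw [delta2, ← ha, ← hHdef, show beta * Real.pi ^ 2 / h ^ 2 = beta * H ^ 2 by
      rw [hHdef]; ring, show h = Real.pi / H by rw [hHdef]; field_simp]
    have h1 : 1 - Real.exp (-(2 * Real.pi ^ 2 / (Real.pi / H) ^ 2)) ≠ 0 := by
      rw [show Real.pi / H = h by rw [hHdef]; field_simp]; linarith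
    field_simp
  rw [hd2]
  have h3 : 0 < 1 - Real.exp (-(2 * Real.pi ^ 2 / h ^ 2)) := by linarith
  refine div_le_div_of_nonneg_right ?_ h3.le
  rw [hexp]
  -- After clearing denominators this is (3a+2H)H ≤ 8xa, which follows from x ≥ 1.4a and a > 3H/4.
  have hmain : 2 * (1 / (4 * √Real.pi) * (1 / (a + H) + 2 / a)) ≤ 4 * x / (√Real.pi * H * (H + a)) := by
    rw [show 2 * (1 / (4 * √Real.pi) * (1 / (a + H) + 2 / a)) =
      (3 * a + 2 * H) * H / (2 * a * (√Real.pi * H * (H + a))) by field_simp; ring,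
      div_le_div_iff₀ (by positivity) (by positivity)]
    have h4 : (3 * a + 2 * H) * H ≤ 4 * x * (2 * a) := by
      have h5 : 1.4 * a ≤ x := by rw [hx2]; gcongr
      nlinarith
    calc _ ≤ 4 * x * (2 * a) * (√Real.pi * H * (H + a)) := by gcongr
      _ = _ := by ring
  -- There is slack: only β ≤ 1/2 is used. Half of the exponent pays for β, and the other half gives
  -- e^{-H²/2} ≤ 1/H through 1 + H²/2 ≥ H.
  have hrest : Real.exp (-H ^ 2) ≤
      4 * x / (√Real.pi * H * (H + a)) * (2 * √Real.pi * Real.exp (-(beta * H ^ 2))) := by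
    have hb : beta ≤ 1 / 2 := by
      have := (abs_lt.1 abs_beta_sub_lt).2
      norm_num at this ⊢
      linarith
    have h6 : Real.exp (-H ^ 2) ≤ Real.exp (-(1 / 2 * H ^ 2)) * Real.exp (-(beta * H ^ 2)) := by
      rw [← Real.exp_add, Real.exp_le_exp]
      nlinarith [sq_nonneg H]
    have h7 : Real.exp (-(1 / 2 * H ^ 2)) ≤ 1 / H := by
      rw [Real.exp_neg, one_div H]
      refine inv_anti₀ hH ?_
      have := Real.add_one_le_exp (1 / 2 * H ^ 2)
      nlinarith [sq_nonneg (H - 1)]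
    have h8 : 1 / H ≤ 8 * x / (H * (H + a)) := by
      rw [div_le_div_iff₀ hH (by positivity)]
      have h5 : 1.4 * a ≤ x := by rw [hx2]; gcongr
      nlinarith
    calc _ ≤ 8 * x / (H * (H + a)) * Real.exp (-(beta * H ^ 2)) := by
          refine h6.trans ?_
          gcongr
          exact h7.trans h8
      _ = _ := by field_simp; ring
  have he0 := Real.exp_pos (-(Real.pi ^ 2 / h ^ 2))
  calc _ = Real.exp (-(Real.pi ^ 2 / h ^ 2)) *
        (2 * (1 / (4 * √Real.pi) * (1 / (a + H) + 2 / a)) + Real.exp (-H ^ 2)) := by ring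
    _ ≤ _ := by
      gcongr
      rw [mul_add _ (1 : ℝ), mul_one]
      exact add_le_add hmain hrest

lemma error_le_Delta {h x : ℝ} (hh : 0 < h) (hx : 0 < x) :
    ‖fresnelF x - modifiedTrapezium h x‖ ≤ Delta h x := by
  have hpi := Real.pi_pos
  have hH : 0 < Real.pi / h := by positivity
  rw [Delta]
  split_ifs with h1 h2
  · exact error_le_delta1 hh hx (by linarith)
  · exact error_le_delta2 hh hx (not_le.1 h1) h2
  · exact error_le_delta3 hh hx (by linarith)

/-! ### Blow-up of δ₁ and boundedness of the piecewise bound -/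

lemma tendsto_delta1 {h : ℝ} (hh : 0 < h) :
    Tendsto (fun x : ℝ => delta1 h x) (𝓝[≠] (√2 * Real.pi / h)) atTop := by
  have hpi := Real.pi_pos
  set p := √2 * Real.pi / h with hp
  have hp0 : 0 < p := by positivity
  have hpp : Real.pi ^ 2 / h ^ 2 = p ^ 2 / 2 := by
    rw [hp, div_pow, mul_pow, Real.sq_sqrt (by norm_num)]; ring
  have hr := exp_neg_pi_lt_one hh
  have h3 : 0 < 1 - Real.exp (-(2 * Real.pi ^ 2 / h ^ 2)) := by linarith
  have h2 : 0 < √Real.pi := Real.sqrt_pos.2 hpi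
  have hden : Tendsto (fun x : ℝ => √Real.pi * |Real.pi ^ 2 / h ^ 2 - x ^ 2 / 2| *
      (1 - Real.exp (-(2 * Real.pi ^ 2 / h ^ 2)))) (𝓝[≠] p) (𝓝[>] 0) := by
    refine tendsto_nhdsWithin_iff.2 ⟨?_, ?_⟩
    · have hc : Continuous fun x : ℝ => √Real.pi * |Real.pi ^ 2 / h ^ 2 - x ^ 2 / 2| *
          (1 - Real.exp (-(2 * Real.pi ^ 2 / h ^ 2))) := by fun_prop
      have := hc.tendsto p
      rw [hpp, sub_self, abs_zero, mul_zero, zero_mul] at this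
      rw [hpp]
      exact this.mono_left nhdsWithin_le_nhds
    · have hx0 : ∀ᶠ x in 𝓝[≠] p, 0 < x := nhdsWithin_le_nhds (Ioi_mem_nhds hp0)
      filter_upwards [hx0, self_mem_nhdsWithin] with x hx hne
      have : Real.pi ^ 2 / h ^ 2 - x ^ 2 / 2 ≠ 0 := by
        rw [hpp]
        intro h0
        have h4 : (p - x) * (p + x) = 0 := by linarith
        rcases mul_eq_zero.1 h4 with h5 | h5
        · exact hne (by rw [mem_singleton_iff]; linarith)
        · linarith
      have := abs_pos.2 this
      rw [mem_Ioi]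
      positivity
  have hnum : Tendsto (fun x : ℝ => x * Real.exp (-(Real.pi ^ 2 / h ^ 2))) (𝓝[≠] p)
      (𝓝 (p * Real.exp (-(Real.pi ^ 2 / h ^ 2)))) :=
    ((continuous_id.mul continuous_const).tendsto p).mono_left nhdsWithin_le_nhds
  simp_rw [delta1, div_eq_mul_inv _ (√Real.pi * |_| * _)]
  exact hnum.pos_mul_atTop (by positivity) (tendsto_inv_nhdsGT_zero.comp hden)

lemma delta1_le {h x : ℝ} (hh : 0 < h) (hx : 0 < x)
    (hfar : x / √2 ≤ 3 / 4 * (Real.pi / h) ∨ 5 / 4 * (Real.pi / h) ≤ x / √2) :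
    delta1 h x ≤ 8 / (Real.pi / h) * (Real.exp (-(Real.pi ^ 2 / h ^ 2)) /
      (√Real.pi * (1 - Real.exp (-(2 * Real.pi ^ 2 / h ^ 2))))) := by
  have hpi := Real.pi_pos
  have hr := exp_neg_pi_lt_one hh
  have h3 : 0 < 1 - Real.exp (-(2 * Real.pi ^ 2 / h ^ 2)) := by linarith
  have h2 : 0 < √Real.pi := Real.sqrt_pos.2 hpi
  have hsqrt : √2 ≤ 2 := by rw [Real.sqrt_le_left (by norm_num)]; norm_num
  have hxa : x ≤ 2 * (x / √2) := by
    have : 0 < x / √2 := by positivity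
    calc x = √2 * (x / √2) := by field_simp
      _ ≤ _ := by gcongr
  have hH : 0 < Real.pi / h := by positivity
  have ha : 0 < x / √2 := by positivity
  rw [delta1, sq_div_two_eq, ← div_pow Real.pi]
  set a := x / √2
  set H := Real.pi / h
  -- Off the middle zone, |H² - a²| is at least 7H²/16 on the left and 9a²/25 on the right. With x ≤
  -- 2a, the constant 8 leaves room in both cases.
  have key : 0 < |H ^ 2 - a ^ 2| ∧ x * H ≤ 8 * |H ^ 2 - a ^ 2| := by
    rcases hfar with h1 | h1
    · have h4 : 0 < H ^ 2 - a ^ 2 := by nlinarith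
      rw [abs_of_pos h4]
      exact ⟨h4, by nlinarith⟩
    · have h4 : H ^ 2 - a ^ 2 < 0 := by nlinarith
      rw [abs_of_neg h4]
      exact ⟨by linarith, by nlinarith⟩
  obtain ⟨h5, h6⟩ := key
  rw [div_mul_div_comm, div_le_div_iff₀ (by positivity) (by positivity)]
  have he := Real.exp_pos (-H ^ 2)
  calc _ = x * H * (Real.exp (-H ^ 2) * (√Real.pi *
        (1 - Real.exp (-(2 * Real.pi ^ 2 / h ^ 2))))) := by ring
    _ ≤ 8 * |H ^ 2 - a ^ 2| * (Real.exp (-H ^ 2) * (√Real.pi *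
        (1 - Real.exp (-(2 * Real.pi ^ 2 / h ^ 2))))) := by gcongr
    _ = _ := by ring

lemma delta2_le {h x : ℝ} (hh : 0 < h) (hx : 0 < x) :
    delta2 h x ≤ 4 * h * √2 * Real.exp (-(Real.pi ^ 2 / h ^ 2)) /
      (√Real.pi * Real.pi * (1 - Real.exp (-(2 * Real.pi ^ 2 / h ^ 2)))) *
      (1 + 2 * √Real.pi * Real.exp (-(beta * Real.pi ^ 2 / h ^ 2))) := by
  have hpi := Real.pi_pos
  have hr := exp_neg_pi_lt_one hh
  have h3 : 0 < 1 - Real.exp (-(2 * Real.pi ^ 2 / h ^ 2)) := by linarith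
  have h2 : 0 < √Real.pi := Real.sqrt_pos.2 hpi
  have hH : 0 < Real.pi / h := by positivity
  have ha : 0 < x / √2 := by positivity
  have hxa : x ≤ √2 * (Real.pi / h + x / √2) := by
    calc x = √2 * (x / √2) := by field_simp
      _ ≤ _ := by gcongr; linarith
  rw [delta2]
  refine mul_le_mul_of_nonneg_right ?_ (by positivity)
  rw [div_le_div_iff₀ (by positivity) (by positivity)]
  have he := Real.exp_pos (-(Real.pi ^ 2 / h ^ 2))
  calc _ = x * (4 * h * Real.exp (-(Real.pi ^ 2 / h ^ 2)) * (√Real.pi * Real.pi *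
        (1 - Real.exp (-(2 * Real.pi ^ 2 / h ^ 2))))) := by ring
    _ ≤ √2 * (Real.pi / h + x / √2) * (4 * h * Real.exp (-(Real.pi ^ 2 / h ^ 2)) *
        (√Real.pi * Real.pi * (1 - Real.exp (-(2 * Real.pi ^ 2 / h ^ 2))))) := by gcongr
    _ = _ := by ring

/-- The exponent √2πx/h equals 2aH, which is at least 2H² beyond the pole, so the correction term is
bounded independently of x. -/
lemma delta3_le {h x : ℝ} (hh : 0 < h) (hge : Real.pi / h ≤ x / √2) :
    delta3 h x ≤ delta1 h x + Real.exp (-(2 * Real.pi ^ 2 / h ^ 2)) /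
      (1 - Real.exp (-(2 * Real.pi ^ 2 / h ^ 2))) := by
  have hpi := Real.pi_pos
  have hr := exp_neg_pi_lt_one hh
  have h3 : 0 < 1 - Real.exp (-(2 * Real.pi ^ 2 / h ^ 2)) := by linarith
  have hle : Real.exp (-(√2 * Real.pi * x / h)) ≤ Real.exp (-(2 * Real.pi ^ 2 / h ^ 2)) := by
    rw [Real.exp_le_exp, neg_le_neg_iff]
    rw [div_sqrt_two] at hge
    have hH : 0 ≤ 2 * (Real.pi / h) := by positivity
    calc _ = Real.pi / h * (2 * (Real.pi / h)) := by ring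
      _ ≤ √2 / 2 * x * (2 * (Real.pi / h)) := mul_le_mul_of_nonneg_right hge hH
      _ = _ := by ring
  rw [delta3]
  gcongr

lemma exists_Delta_le {h : ℝ} (hh : 0 < h) : ∃ C : ℝ, ∀ x : ℝ, 0 < x → Delta h x ≤ C := by
  have hpi := Real.pi_pos
  have hr := exp_neg_pi_lt_one hh
  have h3 : 0 < 1 - Real.exp (-(2 * Real.pi ^ 2 / h ^ 2)) := by linarith
  have hH : 0 < Real.pi / h := by positivity
  obtain ⟨C₁, hC₁0, hC₁⟩ : ∃ C : ℝ, 0 ≤ C ∧ ∀ x : ℝ, 0 < x →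
      (x / √2 ≤ 3 / 4 * (Real.pi / h) ∨ 5 / 4 * (Real.pi / h) ≤ x / √2) → delta1 h x ≤ C :=
    ⟨_, by positivity, fun x hx hfar => delta1_le hh hx hfar⟩
  obtain ⟨C₂, hC₂0, hC₂⟩ : ∃ C : ℝ, 0 ≤ C ∧ ∀ x : ℝ, 0 < x → delta2 h x ≤ C :=
    ⟨_, by positivity, fun x hx => delta2_le hh hx⟩
  obtain ⟨C₃, hC₃0, hC₃⟩ : ∃ C : ℝ, 0 ≤ C ∧ ∀ x : ℝ, 0 < x → Real.pi / h ≤ x / √2 →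
      delta3 h x ≤ delta1 h x + C :=
    ⟨_, by positivity, fun x _ hge => delta3_le hh hge⟩
  refine ⟨C₁ + C₂ + C₃, fun x hx => ?_⟩
  rw [Delta]
  split_ifs with h1 h2
  · linarith [hC₁ x hx (Or.inl h1)]
  · linarith [hC₂ x hx]
  · have h4 := hC₁ x hx (Or.inr (not_lt.1 h2))
    have h5 := hC₃ x hx (by linarith)
    linarith

end FresnelTrapezium

end

theorem theorem1 (h : ℝ) (hh : 0 < h) :
    (∀ x : ℝ, 0 < x →
      Tendsto (fun R : ℝ => FresnelTrapezium.fresnelPartial x R) atTop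
          (𝓝 (FresnelTrapezium.fresnelF x)) ∧
      MeasureTheory.Integrable (fun t : ℝ => FresnelTrapezium.integrand x t) ∧
      (∫ t : ℝ, FresnelTrapezium.integrand x t) = FresnelTrapezium.fresnelF x ∧
      Summable (fun k : ℤ => FresnelTrapezium.integrand x (FresnelTrapezium.node h k)) ∧
      ‖FresnelTrapezium.fresnelF x - FresnelTrapezium.modifiedTrapezium h x‖
        ≤ FresnelTrapezium.Delta h x) ∧
    |FresnelTrapezium.beta - 0.0536| < 0.00005 ∧
    Tendsto (fun x : ℝ => FresnelTrapezium.delta1 h x)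
      (𝓝[≠] (Real.sqrt 2 * Real.pi / h)) atTop ∧
    (∃ C : ℝ, ∀ x : ℝ, 0 < x → FresnelTrapezium.Delta h x ≤ C) := by
  refine ⟨fun x hx => ⟨?_, ?_, ?_, FresnelTrapezium.summable_integrand_node hh hx,
    FresnelTrapezium.error_le_Delta hh hx⟩, FresnelTrapezium.abs_beta_sub_lt,
    FresnelTrapezium.tendsto_delta1 hh, FresnelTrapezium.exists_Delta_le hh⟩
  · rw [FresnelTrapezium.fresnelF_eq hx]
    exact FresnelTrapezium.tendsto_fresnelPartial hx
  · simpa using (FresnelTrapezium.integrable_exp_mul_integrand hx 0).1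
  · rw [FresnelTrapezium.fresnelF_eq hx, FresnelTrapezium.fourierAt]
    simp
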